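/- **Theorem 3.1.** Let $K$ be a field, let $n\ge 0$, and let $G$ be a finite subgroup of $\mathrm{GL}_n(K)$ acting on the polynomial ring $R=K[x_1,\dots,x_n]$ by $K$-algebra automorphisms, where $g\in G$ acts by the substitution $X\mapsto gX$, with $X$ the column vector of the indeterminates; write $R^G$ for the ring of invariants. Assume that $G$ contains no transvections, i.e. no matrix $g$ such that $g-I$ has rank one and $(g-I)^2=0$. Let $\mathfrak m=(x_1,\dots,x_n)$ and $\mathfrak n=\mathfrak m\cap R^G$ be the homogeneous maximal ideals of $R$ and of $R^G$. Then there is an exact sequence of $R^G$-modules $$\bigoplus_{g\in G}H^n_{\mathfrak m}(R)\xrightarrow{\ \alpha\ }H^n_{\mathfrak m}(R)\xrightarrow{\ \mathrm{Tr}\ }H^n_{\mathfrak n}(R^G)\longrightarrow 0,$$ where $$\alpha\colon(\eta_g)_{g\in G}\longmapsto\sum_{g\in G}\bigl(\eta_g-g(\eta_g)\bigr),$$ the map $\eta\mapsto g(\eta)$ on $H^n_{\mathfrak m}(R)$ is the one induced by the automorphism $g$ of $R$ (which preserves $\mathfrak m$), and $\mathrm{Tr}$ is the composite of the canonical map $H^n_{\mathfrak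 m}(R)\to H^n_{\mathfrak n}(R)$ (an identification, as $\mathfrak nR$ has radical $\mathfrak m$) with the map $H^n_{\mathfrak n}(R)\to H^n_{\mathfrak n}(R^G)$ induced by the $R^G$-linear transfer map $R\to R^G$, $r\mapsto\sum_{g\in G}g(r)$. -/

import Mathlib

open CategoryTheory

universe u

noncomputable section

namespace LocCoh

/-! ### Local cohomology

For an ideal `I` of a commutative ring `A` and an `A`-module `M`, the local cohomology module is
`H^i_I(M) = colim_t Ext^i_A(A / I^t, M)`. The `Ext` modules used here are the ones defined
through the derived category (`CategoryTheory.Abelian.Ext`), because these come with the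
functoriality along exact functors that is needed to change the base ring; otherwise this is
the definition of Mathlib's `localCohomology I i`. -/

section General

variable {A : Type u} [CommRing A]

/-- The `A`-module `A / I^t`. -/
abbrev quotPow (I : Ideal A) (t : ℕ) : ModuleCat.{u} A := ModuleCat.of A (A ⧸ I ^ t)

/-- The canonical surjection `A / I^t' → A / I^t` for `t ≤ t'`. -/
def quotPowMap (I : Ideal A) {t t' : ℕ} (h : t ≤ t') : quotPow I t' ⟶ quotPow I t :=
  ModuleCat.ofHom (Submodule.mapQ (I ^ t') (I ^ t) LinearMap.id (Ideal.pow_le_pow_right h))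

lemma quotPowMap_refl (I : Ideal A) (t : ℕ) : quotPowMap I (le_refl t) = 𝟙 _ := by
  ext
  rfl

lemma quotPowMap_comp (I : Ideal A) {t t' t'' : ℕ} (h : t ≤ t') (h' : t' ≤ t'') :
    quotPowMap I h' ≫ quotPowMap I h = quotPowMap I (h.trans h') := by
  ext
  rfl

/-- `Ext^i(A / I^t, M)`. -/
abbrev extQuot (I : Ideal A) (M : ModuleCat.{u} A) (i t : ℕ) : Type u :=
  Abelian.Ext.{u} (quotPow I t) M i

/-- The map `Ext^i(A / I^t, M) → Ext^i(A / I^t', M)` induced by `A / I^t' → A / I^t`. -/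
def extTransition (I : Ideal A) (M : ModuleCat.{u} A) (i t t' : ℕ) (h : t ≤ t') :
    extQuot I M i t →ₗ[A] extQuot I M i t' :=
  Abelian.Ext.precompOfLinear (Abelian.Ext.mk₀ (quotPowMap I h)) A M (zero_add i)

lemma extTransition_apply (I : Ideal A) (M : ModuleCat.{u} A) (i t t' : ℕ) (h : t ≤ t')
    (x : extQuot I M i t) :
    extTransition I M i t t' h x = (Abelian.Ext.mk₀ (quotPowMap I h)).comp x (zero_add i) :=
  rfl

instance (I : Ideal A) (M : ModuleCat.{u} A) (i : ℕ) :
    DirectedSystem (extQuot I M i) (extTransition I M i · · ·) where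
  map_self t x := by
    rw [extTransition_apply, quotPowMap_refl, Abelian.Ext.mk₀_id_comp]
  map_map t t' t'' h h' x := by
    rw [extTransition_apply, extTransition_apply, extTransition_apply,
      ← quotPowMap_comp I h h', Abelian.Ext.mk₀_comp_mk₀_assoc]

/-- The local cohomology module `H^i_I(M) = colim_t Ext^i(A / I^t, M)`. -/
def H (I : Ideal A) (i : ℕ) (M : ModuleCat.{u} A) : Type u :=
  DirectLimit (extQuot I M i) (extTransition I M i)

instance (I : Ideal A) (i : ℕ) (M : ModuleCat.{u} A) : AddCommGroup (H I i M) :=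
  inferInstanceAs (AddCommGroup (DirectLimit (extQuot I M i) (extTransition I M i)))

instance (I : Ideal A) (i : ℕ) (M : ModuleCat.{u} A) : Module A (H I i M) :=
  inferInstanceAs (Module A (DirectLimit (extQuot I M i) (extTransition I M i)))

/-- The canonical map `Ext^i(A / I^t, M) → H^i_I(M)`. -/
def H.of (I : Ideal A) (i : ℕ) (M : ModuleCat.{u} A) (t : ℕ) : extQuot I M i t →ₗ[A] H I i M :=
  DirectLimit.Module.of A ℕ (extQuot I M i) (extTransition I M i) t

lemma H.of_transition (I : Ideal A) (i : ℕ) (M : ModuleCat.{u} A) {t t' : ℕ} (h : t ≤ t')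
    (x : extQuot I M i t) : H.of I i M t' (extTransition I M i t t' h x) = H.of I i M t x :=
  DirectLimit.Module.of_f (f := extTransition I M i)

/-! ### Functoriality

Let `φ : A → B` be a ring homomorphism, `I` an ideal of `A` and `J` an ideal of `B` with
`φ(I) ⊆ J`, let `M` be a `B`-module, `N` an `A`-module and `ψ : M → N` a map that is `A`-linear
when `M` is viewed as an `A`-module through `φ`. Then there is an induced map
`H^i_J(M) → H^i_I(N)`, which in degree `0` is the restriction of `ψ`
to the submodule of elements of `M` killed by a power of `J`. -/

variable {B : Type u} [CommRing B]

lemma pow_le_comap_pow (φ : A →+* B) {I : Ideal A} {J : Ideal B} (h : I ≤ J.comap φ) (t : ℕ) :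
    I ^ t ≤ (J ^ t).comap φ :=
  (Ideal.pow_right_mono h t).trans (Ideal.le_comap_pow φ t)

/-- The map `A / I^t → B / J^t` induced by `φ`. -/
def quotPowChange (φ : A →+* B) {I : Ideal A} {J : Ideal B} (h : I ≤ J.comap φ) (t : ℕ) :
    quotPow I t ⟶ (ModuleCat.restrictScalars φ).obj (quotPow J t) :=
  ModuleCat.ofHom (Y := (ModuleCat.restrictScalars φ).obj (quotPow J t))
    { toFun := Ideal.quotientMap (J ^ t) φ (pow_le_comap_pow φ h t)
      map_add' := map_add _
      map_smul' := by
        rintro a x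
        obtain ⟨x, rfl⟩ := Ideal.Quotient.mk_surjective x
        change Ideal.Quotient.mk (J ^ t) (φ (a * x)) =
          Ideal.Quotient.mk (J ^ t) (φ a) * Ideal.Quotient.mk (J ^ t) (φ x)
        rw [map_mul, map_mul] }

lemma quotPowChange_transition (φ : A →+* B) {I : Ideal A} {J : Ideal B} (h : I ≤ J.comap φ)
    {t t' : ℕ} (ht : t ≤ t') :
    quotPowChange φ h t' ≫ (ModuleCat.restrictScalars φ).map (quotPowMap J ht) =
      quotPowMap I ht ≫ quotPowChange φ h t := by
  ext
  rfl

/-- The composite `Ext_B^i(B / J^t, M) → Ext_A^i(B / J^t, M) → Ext_A^i(A / I^t, M) →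
Ext_A^i(A / I^t, N)` of restriction of scalars, the map `A / I^t → B / J^t`, and `ψ`. -/
def extChange (φ : A →+* B) {I : Ideal A} {J : Ideal B} (h : I ≤ J.comap φ) (i : ℕ)
    {M : ModuleCat.{u} B} {N : ModuleCat.{u} A}
    (ψ : (ModuleCat.restrictScalars φ).obj M ⟶ N) (t : ℕ) (x : extQuot J M i t) :
    extQuot I N i t :=
  ((Abelian.Ext.mk₀ (quotPowChange φ h t)).comp
    (x.mapExactFunctor (ModuleCat.restrictScalars φ)) (zero_add i)).comp
      (Abelian.Ext.mk₀ ψ) (add_zero i)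

section

variable (φ : A →+* B) {I : Ideal A} {J : Ideal B} (h : I ≤ J.comap φ) (i : ℕ)
  {M : ModuleCat.{u} B} {N : ModuleCat.{u} A} (ψ : (ModuleCat.restrictScalars φ).obj M ⟶ N)

lemma extChange_add (t : ℕ) (x y : extQuot J M i t) :
    extChange φ h i ψ t (x + y) = extChange φ h i ψ t x + extChange φ h i ψ t y := by
  simp [extChange]

lemma extChange_smul (t : ℕ) (a : A) (x : extQuot J M i t) :
    extChange φ h i ψ t (φ a • x) = a • extChange φ h i ψ t x := by
  have key : (ModuleCat.restrictScalars φ).map (φ a • 𝟙 M) =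
      a • 𝟙 ((ModuleCat.restrictScalars φ).obj M) := by
    ext x
    rfl
  have : (φ a • x).mapExactFunctor (ModuleCat.restrictScalars φ) =
      a • x.mapExactFunctor (ModuleCat.restrictScalars φ) := by
    rw [Abelian.Ext.smul_eq_comp_mk₀, Abelian.Ext.mapExactFunctor_comp,
      Abelian.Ext.mapExactFunctor_mk₀, key, ← Abelian.Ext.smul_eq_comp_mk₀]
  rw [extChange, this, Abelian.Ext.comp_smul, Abelian.Ext.smul_comp, extChange]

lemma extChange_transition (t t' : ℕ) (ht : t ≤ t') (x : extQuot J M i t) :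
    extChange φ h i ψ t' (extTransition J M i t t' ht x) =
      extTransition I N i t t' ht (extChange φ h i ψ t x) := by
  rw [extTransition_apply, extTransition_apply, extChange, extChange,
    Abelian.Ext.mapExactFunctor_comp, Abelian.Ext.mapExactFunctor_mk₀,
    Abelian.Ext.mk₀_comp_mk₀_assoc, quotPowChange_transition,
    ← Abelian.Ext.mk₀_comp_mk₀_assoc]
  rw [Abelian.Ext.comp_assoc _ _ _ (zero_add i) (add_zero i) (by simp)]

/-- The map `H^i_J(M) → H^i_I(N)` induced by `φ` and `ψ`. -/
def H.map : H J i M →+ H I i N where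
  toFun := DirectLimit.lift (extTransition J M i)
    (fun t x => H.of I i N t (extChange φ h i ψ t x))
    (fun t t' ht x => by rw [extChange_transition, H.of_transition])
  map_zero' := by
    have : (0 : H J i M) = H.of J i M 0 0 := (map_zero _).symm
    rw [this]
    change H.of I i N 0 (extChange φ h i ψ 0 0) = 0
    have h0 : extChange φ h i ψ 0 0 = 0 := by simp [extChange]
    rw [h0, map_zero]
  map_add' x y := by
    induction x, y using DirectLimit.induction₂ with | _ t x y
    change DirectLimit.lift _ _ _ (H.of J i M t x + H.of J i M t y) = _
    rw [← map_add]
    change H.of I i N t (extChange φ h i ψ t (x + y)) =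
      H.of I i N t (extChange φ h i ψ t x) + H.of I i N t (extChange φ h i ψ t y)
    rw [extChange_add, map_add]

lemma H.map_of (t : ℕ) (x : extQuot J M i t) :
    H.map φ h i ψ (H.of J i M t x) = H.of I i N t (extChange φ h i ψ t x) :=
  rfl

lemma H.map_smul (a : A) (x : H J i M) :
    H.map φ h i ψ (φ a • x) = a • H.map φ h i ψ x := by
  induction x using DirectLimit.induction with | _ t x
  change H.map φ h i ψ (φ a • H.of J i M t x) = a • H.map φ h i ψ (H.of J i M t x)
  rw [← _root_.map_smul, H.map_of, H.map_of, extChange_smul, _root_.map_smul]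

/-- An additive map `f : M → N` with `f (φ(a) x) = a f(x)`, as a morphism of `A`-modules. -/
def resHom (φ : A →+* B) {M N : Type u} [AddCommGroup M] [Module B M] [AddCommGroup N]
    [Module A N] (f : M →+ N) (hf : ∀ (a : A) (x : M), f (φ a • x) = a • f x) :
    (ModuleCat.restrictScalars φ).obj (ModuleCat.of B M) ⟶ ModuleCat.of A N :=
  ModuleCat.ofHom (X := (ModuleCat.restrictScalars φ).obj (ModuleCat.of B M))
    { toFun := f
      map_add' := map_add f
      map_smul' := hf }

end

end General

/-! ### Finite linear groups acting on polynomial rings -/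

section Invariants

open MvPolynomial

variable {K : Type u} [Field K] {n : ℕ}

/-- A transvection: a matrix `g` with `g - 1` of rank one (a pseudoreflection) whose only
eigenvalue is `1`, that is, one whose Jordan form consists of one block of size two and
blocks of size one, all with eigenvalue `1`. -/
def IsTransvection (g : GL (Fin n) K) : Prop :=
  ((g : Matrix (Fin n) (Fin n) K) - 1).rank = 1 ∧ ((g : Matrix (Fin n) (Fin n) K) - 1) ^ 2 = 0

/-- The substitution `X ↦ gX`, where `X` is the column vector of the indeterminates. -/
def act (g : GL (Fin n) K) : MvPolynomial (Fin n) K →ₐ[K] MvPolynomial (Fin n) K :=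
  aeval fun i => ∑ j, C ((g : Matrix (Fin n) (Fin n) K) i j) * X j

lemma act_X (g : GL (Fin n) K) (i : Fin n) :
    act g (X i) = ∑ j, C ((g : Matrix (Fin n) (Fin n) K) i j) * X j := by
  simp [act]

lemma act_act (g h : GL (Fin n) K) (f : MvPolynomial (Fin n) K) :
    act g (act h f) = act (h * g) f := by
  have : (act g).comp (act h) = act (h * g) := by
    apply MvPolynomial.algHom_ext
    intro i
    simp only [AlgHom.comp_apply, act_X, map_sum, map_mul, Units.val_mul, Matrix.mul_apply,
      Finset.sum_mul, Finset.mul_sum, ← mul_assoc]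
    rw [Finset.sum_comm]
    simp [act]
  exact DFunLike.congr_fun this f

lemma act_one (f : MvPolynomial (Fin n) K) : act 1 f = f := by
  have : act (1 : GL (Fin n) K) = AlgHom.id K _ := by
    apply MvPolynomial.algHom_ext
    intro i
    simp [act_X, Matrix.one_apply]
  rw [this, AlgHom.id_apply]

/-- The homogeneous maximal ideal `(x_1, …, x_n)` of the polynomial ring. -/
def maxIdeal (K : Type u) [Field K] (n : ℕ) : Ideal (MvPolynomial (Fin n) K) :=
  Ideal.span (Set.range X)

lemma maxIdeal_le_comap_act (g : GL (Fin n) K) :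
    maxIdeal K n ≤ (maxIdeal K n).comap (act g : _ →+* MvPolynomial (Fin n) K) := by
  refine Ideal.span_le.2 ?_
  rintro _ ⟨i, rfl⟩
  change act g (X i) ∈ maxIdeal K n
  rw [act_X]
  exact Ideal.sum_mem _ fun j _ => Ideal.mul_mem_left _ _ (Ideal.subset_span ⟨j, rfl⟩)

variable (G : Subgroup (GL (Fin n) K))

/-- The invariant ring `R^G`. -/
def invariants : Subalgebra K (MvPolynomial (Fin n) K) where
  carrier := {f | ∀ g ∈ G, act g f = f}
  mul_mem' ha hb g hg := by rw [map_mul, ha g hg, hb g hg]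
  add_mem' ha hb g hg := by rw [map_add, ha g hg, hb g hg]
  algebraMap_mem' r g _ := AlgHom.commutes _ _

/-- The homogeneous maximal ideal of `R^G`, i.e. the ideal of invariants with zero constant
term. -/
def invMaxIdeal : Ideal (invariants G) :=
  (maxIdeal K n).comap (algebraMap (invariants G) (MvPolynomial (Fin n) K))

/-- The local cohomology module `H^n_𝔪(R)`. -/
abbrev HR (K : Type u) [Field K] (n : ℕ) : Type u :=
  H (maxIdeal K n) n (ModuleCat.of (MvPolynomial (Fin n) K) (MvPolynomial (Fin n) K))

/-- The local cohomology module `H^n_𝔫(R^G)`. -/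
abbrev HInv : Type u :=
  H (invMaxIdeal G) n (ModuleCat.of (invariants G) (invariants G))

/-- `act g : R → R`, viewed as an `R`-linear map whose source has the `R`-module structure
through `act g⁻¹ : R → R`. -/
def actHom (g : GL (Fin n) K) :
    (ModuleCat.restrictScalars (act g⁻¹ : MvPolynomial (Fin n) K →+* MvPolynomial (Fin n) K)).obj
        (ModuleCat.of (MvPolynomial (Fin n) K) (MvPolynomial (Fin n) K)) ⟶
      ModuleCat.of (MvPolynomial (Fin n) K) (MvPolynomial (Fin n) K) :=
  resHom (act g⁻¹ : MvPolynomial (Fin n) K →+* MvPolynomial (Fin n) K)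
    (act g : MvPolynomial (Fin n) K →+ MvPolynomial (Fin n) K)
    fun a x => by
      change act g (act g⁻¹ a * x) = a * act g x
      rw [map_mul, act_act, inv_mul_cancel, act_one]

/-- The map `g : H^n_𝔪(R) → H^n_𝔪(R)` that the automorphism `act g` of `R`, which
preserves `𝔪`, induces by transport of structure. -/
def actAdd (g : GL (Fin n) K) : HR K n →+ HR K n :=
  H.map (act g⁻¹ : MvPolynomial (Fin n) K →+* MvPolynomial (Fin n) K)
    (maxIdeal_le_comap_act g⁻¹) n (actHom g)

lemma actAdd_smul (g : GL (Fin n) K) (a : MvPolynomial (Fin n) K) (x : HR K n) :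
    actAdd g (act g⁻¹ a • x) = a • actAdd g x :=
  H.map_smul (act g⁻¹ : MvPolynomial (Fin n) K →+* MvPolynomial (Fin n) K)
    (maxIdeal_le_comap_act g⁻¹) n (actHom g) a x

/-- For `g ∈ G`, the map `g : H^n_𝔪(R) → H^n_𝔪(R)` is linear over `R^G`. -/
def actH (g : G) : HR K n →ₗ[invariants G] HR K n where
  toFun := actAdd (g : GL (Fin n) K)
  map_add' := map_add _
  map_smul' s x := by
    have h := actAdd_smul (g : GL (Fin n) K) (s : MvPolynomial (Fin n) K) x
    rw [s.2 _ (G.inv_mem g.2)] at h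
    exact h

variable [Fintype G]

/-- The transfer `R → R^G`, `f ↦ ∑_{g ∈ G} g(f)`. -/
def transfer : MvPolynomial (Fin n) K →ₗ[invariants G] invariants G where
  toFun f := ⟨∑ g : G, act (g : GL (Fin n) K) f, fun h hh => by
    rw [map_sum]
    simp only [act_act]
    exact Fintype.sum_equiv (Equiv.mulRight (⟨h, hh⟩ : G)) _ _ fun g => rfl⟩
  map_add' f f' := Subtype.ext (by simp [Finset.sum_add_distrib])
  map_smul' s f := Subtype.ext (by
    change ∑ g : G, act (g : GL (Fin n) K) ((s : MvPolynomial (Fin n) K) * f) =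
      (s : MvPolynomial (Fin n) K) * ∑ g : G, act (g : GL (Fin n) K) f
    rw [Finset.mul_sum]
    exact Finset.sum_congr rfl fun g _ => by rw [map_mul, s.2 g g.2])

/-- The transfer as a morphism of `R^G`-modules. -/
def transferHom :
    (ModuleCat.restrictScalars (algebraMap (invariants G) (MvPolynomial (Fin n) K))).obj
        (ModuleCat.of (MvPolynomial (Fin n) K) (MvPolynomial (Fin n) K)) ⟶
      ModuleCat.of (invariants G) (invariants G) :=
  resHom (algebraMap (invariants G) (MvPolynomial (Fin n) K)) (transfer G).toAddMonoidHom
    fun a x => (transfer G).map_smul a x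

/-- The map `H^n_𝔪(R) → H^n_𝔫(R^G)` induced by the transfer, i.e. the composite of the canonical
map `H^n_𝔪(R) → H^n_𝔫(R)` with the map `H^n_𝔫(R) → H^n_𝔫(R^G)` obtained from the
`R^G`-linear map `R → R^G` by functoriality. -/
def transferH : HR K n →ₗ[invariants G] HInv G where
  toFun := H.map (algebraMap (invariants G) (MvPolynomial (Fin n) K)) (le_refl (invMaxIdeal G))
    n (transferHom G)
  map_add' := map_add _
  map_smul' s x := H.map_smul (algebraMap (invariants G) (MvPolynomial (Fin n) K)) _ n
    (transferHom G) s x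

/-- The map `⨁_{g ∈ G} H^n_𝔪(R) → H^n_𝔪(R)`, `(η_g) ↦ ∑_g (η_g - g(η_g))`. -/
def alpha : (DirectSum G fun _ => HR K n) →ₗ[invariants G] HR K n :=
  ∑ g : G, (LinearMap.id - actH G g) ∘ₗ DirectSum.component (invariants G) G (fun _ => HR K n) g

lemma alpha_apply (η : DirectSum G fun _ => HR K n) :
    alpha G η = ∑ g : G, (η g - actH G g (η g)) := by
  rw [alpha, LinearMap.sum_apply]
  rfl

end Invariants

end LocCoh

end

/-! Everything is moved to the invariant ring A = R^G. Since 𝔫R is 𝔪-primary, restriction of scalars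
identifies H^n_𝔪(R) with H^n_𝔫(R) (`H.res_bijective`), compatibly with G (`resH_actH`). It remains
to apply H^n_𝔫 to the complex of A-modules ∏_G R → R → A given by `alphaHom` and the transfer Tr.

This complex need not be exact, but its defects are small. The image of Tr is an ideal of A, so it
kills the cokernel; and Tr(r)x = ∑_g (g⁻¹(r)x − g(g⁻¹(r)x)) when Tr(x) = 0 (`transfer_mul_eq`), so
it kills the middle homology as well.

Let a prime P of R contain the image of Tr. By independence of characters, p = char K divides the
order of the inertia group of P (`card_inertia_eq_zero`). An element g of order p in it has g − 1
nilpotent and nonzero, and not of rank one because g is no transvection; so P contains two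
independent linear forms (`exists_fixIdeal_le`). Modules killed by the image of Tr therefore live in
dimension at most n − 2 and have no H^{n-1} or H^n (`H.subsingleton_of_transfer_smul`). Together
with H^{n+1} = 0 (`H.subsingleton_of_gt`) the long exact sequences give the claim
(`H.exact_of_smul`).

Vanishing and independence of the base ring both rest on dimension shifting: over a noetherian ring
torsion submodules of injectives are injective (`injective_tors`). Noether normalization supplies
parameters and counts them. -/

noncomputable section

namespace LocCoh

/-! ### Functoriality in the module and long exact sequences -/

section Postcomp

variable {A : Type u} [CommRing A] {I : Ideal A}

lemma H.exists_of {i : ℕ} {M : ModuleCat.{u} A} (x : H I i M) :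
    ∃ t y, H.of I i M t y = x := by
  induction x using DirectLimit.induction with | _ t x
  exact ⟨t, x, rfl⟩

lemma H.of_eq_zero_iff {i : ℕ} {M : ModuleCat.{u} A} {t : ℕ} (x : extQuot I M i t) :
    H.of I i M t x = 0 ↔ ∃ t', ∃ h : t ≤ t', extTransition I M i t t' h x = 0 := by
  constructor
  · intro hx
    have h0 : H.of I i M t x = H.of I i M t 0 := by rw [hx, map_zero]
    obtain ⟨t', h, h', e⟩ : ∃ t', ∃ (h : t ≤ t') (h' : t ≤ t'),
      extTransition I M i t t' h x = extTransition I M i t t' h' 0 := Quotient.exact h0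
    exact ⟨t', h, e.trans (map_zero _)⟩
  · rintro ⟨t', h, e⟩
    rw [← H.of_transition I i M h, e, map_zero]

/-- Composition with a class in `Ext^b(M, N)`, as a map `H^i_I(M) → H^j_I(N)`, `j = i + b`. -/
def H.postcomp {M N : ModuleCat.{u} A} {b i j : ℕ} (β : Abelian.Ext.{u} M N b) (h : i + b = j) :
    H I i M →+ H I j N where
  toFun := DirectLimit.lift (extTransition I M i)
    (fun t x => H.of I j N t (x.comp β h))
    (fun t t' ht x => by
      rw [← H.of_transition I j N ht]
      congr 1
      rw [extTransition_apply, extTransition_apply]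
      exact (Abelian.Ext.comp_assoc _ _ _ _ _ (by omega)).symm)
  map_zero' := by
    have : (0 : H I i M) = H.of I i M 0 0 := (map_zero _).symm
    rw [this]
    change H.of I j N 0 ((0 : extQuot I M i 0).comp β h) = 0
    rw [Abelian.Ext.zero_comp, map_zero]
  map_add' x y := by
    induction x, y using DirectLimit.induction₂ with | _ t x y
    change DirectLimit.lift _ _ _ (H.of I i M t x + H.of I i M t y) = _
    rw [← map_add]
    change H.of I j N t ((x + y).comp β h) =
      H.of I j N t (x.comp β h) + H.of I j N t (y.comp β h)
    rw [Abelian.Ext.add_comp, map_add]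

lemma H.postcomp_of {M N : ModuleCat.{u} A} {b i j : ℕ} (β : Abelian.Ext.{u} M N b)
    (h : i + b = j) (t : ℕ) (x : extQuot I M i t) :
    H.postcomp β h (H.of I i M t x) = H.of I j N t (x.comp β h) := rfl

lemma H.postcomp_postcomp {M N P : ModuleCat.{u} A} {b c d i j k : ℕ}
    (β : Abelian.Ext.{u} M N b) (γ : Abelian.Ext.{u} N P c) (h : i + b = j) (h' : j + c = k)
    (h'' : b + c = d) (x : H I i M) :
    H.postcomp γ h' (H.postcomp β h x) =
      H.postcomp (β.comp γ h'') (show i + d = k by omega) x := by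
  obtain ⟨t, x, rfl⟩ := H.exists_of x
  rw [H.postcomp_of, H.postcomp_of, H.postcomp_of]
  congr 1
  exact Abelian.Ext.comp_assoc _ _ _ _ _ (by omega)

lemma H.postcomp_zero {M N : ModuleCat.{u} A} {b i j : ℕ} (h : i + b = j) (x : H I i M) :
    H.postcomp (0 : Abelian.Ext.{u} M N b) h x = 0 := by
  obtain ⟨t, x, rfl⟩ := H.exists_of x
  rw [H.postcomp_of, Abelian.Ext.comp_zero, map_zero]

lemma H.postcomp_add {M N : ModuleCat.{u} A} {b i j : ℕ} (β γ : Abelian.Ext.{u} M N b)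
    (h : i + b = j) (x : H I i M) :
    H.postcomp (β + γ) h x = H.postcomp β h x + H.postcomp γ h x := by
  obtain ⟨t, x, rfl⟩ := H.exists_of x
  rw [H.postcomp_of, H.postcomp_of, H.postcomp_of, Abelian.Ext.comp_add, map_add]

/-- The map `H^i_I(M) → H^i_I(N)` induced by a morphism `M ⟶ N`. -/
def H.push {M N : ModuleCat.{u} A} (i : ℕ) (f : M ⟶ N) : H I i M →+ H I i N :=
  H.postcomp (Abelian.Ext.mk₀ f) (add_zero i)

lemma H.push_push {M N P : ModuleCat.{u} A} {i : ℕ} (f : M ⟶ N) (g : N ⟶ P) (x : H I i M) :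
    H.push i g (H.push i f x) = H.push i (f ≫ g) x := by
  rw [H.push, H.push, H.postcomp_postcomp _ _ _ _ (add_zero 0), Abelian.Ext.mk₀_comp_mk₀, H.push]

lemma H.push_add {M N : ModuleCat.{u} A} {i : ℕ} (f g : M ⟶ N) (x : H I i M) :
    H.push i (f + g) x = H.push i f x + H.push i g x := by
  rw [H.push, Abelian.Ext.mk₀_add, H.postcomp_add]; rfl

/-- `H.push` as an additive function of the morphism. -/
def H.pushHom {M N : ModuleCat.{u} A} (i : ℕ) (x : H I i M) : (M ⟶ N) →+ H I i N :=
  AddMonoidHom.mk' (fun f => H.push i f x) fun f g => H.push_add f g x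

lemma H.push_sub {M N : ModuleCat.{u} A} {i : ℕ} (f g : M ⟶ N) (x : H I i M) :
    H.push i (f - g) x = H.push i f x - H.push i g x :=
  map_sub (H.pushHom i x) f g

lemma H.push_sum {M N : ModuleCat.{u} A} {i : ℕ} {ι : Type*} (s : Finset ι) (f : ι → (M ⟶ N))
    (x : H I i M) : H.push i (∑ k ∈ s, f k) x = ∑ k ∈ s, H.push i (f k) x :=
  map_sum (H.pushHom i x) f s

section LongExact

variable {S : ShortComplex (ModuleCat.{u} A)} (hS : S.ShortExact)

/-- The connecting homomorphism `H^i_I(S.X₃) → H^{i+1}_I(S.X₁)`. -/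
def H.connecting (i : ℕ) : H I i S.X₃ →+ H I (i + 1) S.X₁ :=
  H.postcomp hS.extClass rfl

/-- The colimit is filtered, so the vanishing already holds at a finite stage t', where the long
exact sequence of Ext provides the preimage. `H.exists_push_eq` and `H.exists_push_eq_of_connecting`
work alike. -/
lemma H.exists_connecting_eq {i : ℕ} (x : H I (i + 1) S.X₁) (hx : H.push (i + 1) S.f x = 0) :
    ∃ y : H I i S.X₃, H.connecting hS i y = x := by
  obtain ⟨t, x, rfl⟩ := H.exists_of x
  rw [H.push, H.postcomp_of, H.of_eq_zero_iff] at hx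
  obtain ⟨t', h, e⟩ := hx
  rw [extTransition_apply, ← Abelian.Ext.comp_assoc_of_third_deg_zero] at e
  obtain ⟨y, hy⟩ := Abelian.Ext.covariant_sequence_exact₁ _ hS _ e (n₀ := i) rfl
  refine ⟨H.of I i _ t' y, ?_⟩
  rw [H.connecting, H.postcomp_of, hy, ← extTransition_apply, H.of_transition]

include hS in
lemma H.exists_push_eq {i : ℕ} (x : H I i S.X₂) (hx : H.push i S.g x = 0) :
    ∃ y : H I i S.X₁, H.push i S.f y = x := by
  obtain ⟨t, x, rfl⟩ := H.exists_of x
  rw [H.push, H.postcomp_of, H.of_eq_zero_iff] at hx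
  obtain ⟨t', h, e⟩ := hx
  rw [extTransition_apply, ← Abelian.Ext.comp_assoc_of_third_deg_zero] at e
  obtain ⟨y, hy⟩ := Abelian.Ext.covariant_sequence_exact₂ _ hS _ e
  refine ⟨H.of I i _ t' y, ?_⟩
  rw [H.push, H.postcomp_of, hy, ← extTransition_apply, H.of_transition]

lemma H.exists_push_eq_of_connecting {i : ℕ} (x : H I i S.X₃) (hx : H.connecting hS i x = 0) :
    ∃ y : H I i S.X₂, H.push i S.g y = x := by
  obtain ⟨t, x, rfl⟩ := H.exists_of x
  rw [H.connecting, H.postcomp_of, H.of_eq_zero_iff] at hx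
  obtain ⟨t', h, e⟩ := hx
  rw [extTransition_apply, ← Abelian.Ext.comp_assoc _ _ _ (zero_add _) rfl (by omega)] at e
  obtain ⟨y, hy⟩ := Abelian.Ext.covariant_sequence_exact₃ _ hS _ rfl e
  refine ⟨H.of I i _ t' y, ?_⟩
  rw [H.push, H.postcomp_of, hy, ← extTransition_apply, H.of_transition]

lemma H.connecting_push {i : ℕ} (x : H I i S.X₂) :
    H.connecting hS i (H.push i S.g x) = 0 := by
  rw [H.push, H.connecting, H.postcomp_postcomp _ _ _ _ (zero_add 1), hS.comp_extClass,
    H.postcomp_zero]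

include hS

lemma H.subsingleton_of_ends {i : ℕ} (h₁ : Subsingleton (H I i S.X₁))
    (h₃ : Subsingleton (H I i S.X₃)) : Subsingleton (H I i S.X₂) := by
  refine subsingleton_of_forall_eq 0 fun x => ?_
  obtain ⟨y, rfl⟩ := H.exists_push_eq hS x (Subsingleton.elim _ _)
  rw [Subsingleton.elim y 0, map_zero]

lemma H.subsingleton_left {i : ℕ} (h₃ : Subsingleton (H I i S.X₃))
    (h₂ : Subsingleton (H I (i + 1) S.X₂)) : Subsingleton (H I (i + 1) S.X₁) := by
  refine subsingleton_of_forall_eq 0 fun x => ?_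
  obtain ⟨y, rfl⟩ := H.exists_connecting_eq hS x (Subsingleton.elim _ _)
  rw [Subsingleton.elim y 0, map_zero]

end LongExact

lemma H.subsingleton_of_injective (E : ModuleCat.{u} A) [Injective E] (i : ℕ) :
    Subsingleton (H I (i + 1) E) := by
  refine subsingleton_of_forall_eq 0 fun x => ?_
  obtain ⟨t, x, rfl⟩ := H.exists_of x
  rw [Abelian.Ext.eq_zero_of_injective x, map_zero]

/-- The local cohomology of a module on which an element of `I` acts bijectively vanishes. -/
lemma H.subsingleton_of_bijective {f : A} (hf : f ∈ I) (M : ModuleCat.{u} A)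
    (hM : Function.Bijective fun x : M => f • x) (i : ℕ) : Subsingleton (H I i M) := by
  refine subsingleton_of_forall_eq 0 fun x => ?_
  obtain ⟨t, x, rfl⟩ := H.exists_of x
  suffices x = 0 by rw [this, map_zero]
  -- On Ext the element f^t acts as zero through A / I^t and invertibly through M.
  have h1 : f ^ t • x = 0 := by
    have : f ^ t • 𝟙 (quotPow I t) = 0 := by
      ext
      change Submodule.Quotient.mk (f ^ t • (1 : A)) = (0 : A ⧸ I ^ t)
      rw [Submodule.Quotient.mk_eq_zero, smul_eq_mul, mul_one]
      exact Ideal.pow_mem_pow hf t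
    have h2 := Abelian.Ext.smul_comp (Abelian.Ext.mk₀ (𝟙 (quotPow I t))) x (zero_add i) (f ^ t)
    rw [Abelian.Ext.mk₀_id_comp, ← Abelian.Ext.mk₀_smul, this, Abelian.Ext.mk₀_zero,
      Abelian.Ext.zero_comp] at h2
    exact h2.symm
  have hit : Function.Bijective fun x : M => f ^ t • x := by
    have : (fun x : M => f ^ t • x) = (fun x => f • x)^[t] := by
      rw [smul_iterate]
    rw [this]
    exact hM.iterate t
  have : IsIso (f ^ t • 𝟙 M) := by
    rw [ConcreteCategory.isIso_iff_bijective]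
    exact hit
  rw [Abelian.Ext.smul_eq_comp_mk₀] at h1
  have h3 := congrArg (fun y => Abelian.Ext.comp y (Abelian.Ext.mk₀ (inv (f ^ t • 𝟙 M)))
    (add_zero i)) h1
  simpa only [Abelian.Ext.comp_assoc_of_third_deg_zero, Abelian.Ext.mk₀_comp_mk₀,
    IsIso.hom_inv_id, Abelian.Ext.comp_mk₀_id, Abelian.Ext.zero_comp] using h3

end Postcomp

/-! ### Exact functors and Ext -/

section MapExact

variable {A B C : Type u} [CommRing A] [CommRing B] [CommRing C]

/-- `mapExactFunctor` is natural with respect to transformations from a composite of two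
exact functors. -/
lemma mapExactFunctor_naturality (F : ModuleCat.{u} A ⥤ ModuleCat.{u} B)
    (G : ModuleCat.{u} B ⥤ ModuleCat.{u} C) (L : ModuleCat.{u} A ⥤ ModuleCat.{u} C)
    [F.Additive] [Limits.PreservesFiniteLimits F] [Limits.PreservesFiniteColimits F]
    [G.Additive] [Limits.PreservesFiniteLimits G] [Limits.PreservesFiniteColimits G]
    [L.Additive] [Limits.PreservesFiniteLimits L] [Limits.PreservesFiniteColimits L]
    (τ : F ⋙ G ⟶ L) {i : ℕ} {X Y : ModuleCat.{u} A} (x : Abelian.Ext.{u} X Y i) :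
    ((x.mapExactFunctor F).mapExactFunctor G).comp (Abelian.Ext.mk₀ (τ.app Y)) (add_zero i) =
      (Abelian.Ext.mk₀ (τ.app X)).comp (x.mapExactFunctor L) (zero_add i) := by
  induction i generalizing Y with
  | zero =>
    obtain ⟨f, rfl⟩ := (Abelian.Ext.mk₀_bijective X Y).2 x
    rw [Abelian.Ext.mapExactFunctor_mk₀, Abelian.Ext.mapExactFunctor_mk₀,
      Abelian.Ext.mapExactFunctor_mk₀, Abelian.Ext.mk₀_comp_mk₀, Abelian.Ext.mk₀_comp_mk₀]
    congr 1
    exact τ.naturality f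
  | succ i ih =>
    -- Dimension shift: with Y inside an injective, x is a class of degree one lower times an
    -- extension class, and extension classes are natural under τ.
    let S := ShortComplex.mk _ _ (Limits.cokernel.condition (Injective.ι Y))
    have hS : S.ShortExact :=
      { exact := ShortComplex.exact_of_g_is_cokernel _ (Limits.cokernelIsCokernel S.f) }
    obtain ⟨y, rfl⟩ := Abelian.Ext.covariant_sequence_exact₁ X hS x
      (Abelian.Ext.eq_zero_of_injective _) rfl
    let S₁ : ShortComplex (ModuleCat.{u} C) := (S.map F).map G
    have h₁ : S₁.ShortExact := (hS.map_of_exact F).map_of_exact G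
    have h₂ : (S.map L).ShortExact := hS.map_of_exact L
    let φ : S₁ ⟶ S.map L :=
      { τ₁ := τ.app S.X₁
        τ₂ := τ.app S.X₂
        τ₃ := τ.app S.X₃
        comm₁₂ := (τ.naturality S.f).symm
        comm₂₃ := (τ.naturality S.g).symm }
    have e₁ : (hS.extClass.mapExactFunctor F).mapExactFunctor G = h₁.extClass :=
      (congrArg (Abelian.Ext.mapExactFunctor G) (Abelian.Ext.mapExactFunctor_extClass F hS)).trans
        (Abelian.Ext.mapExactFunctor_extClass G _)
    have e₂ : hS.extClass.mapExactFunctor L = h₂.extClass :=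
      Abelian.Ext.mapExactFunctor_extClass L hS
    have nat : ((hS.extClass.mapExactFunctor F).mapExactFunctor G).comp
        (Abelian.Ext.mk₀ (τ.app S.X₁)) (add_zero 1) =
        (Abelian.Ext.mk₀ (τ.app S.X₃)).comp (hS.extClass.mapExactFunctor L) (zero_add 1) :=
      (congrArg (fun z => Abelian.Ext.comp z (Abelian.Ext.mk₀ (τ.app S.X₁)) (add_zero 1)) e₁).trans
        ((ShortComplex.ShortExact.extClass_naturality h₁ h₂ φ).trans
          (congrArg (fun z => Abelian.Ext.comp (Abelian.Ext.mk₀ (τ.app S.X₃)) z (zero_add 1))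
            e₂.symm))
    rw [Abelian.Ext.mapExactFunctor_comp, Abelian.Ext.mapExactFunctor_comp,
      Abelian.Ext.mapExactFunctor_comp, Abelian.Ext.comp_assoc_of_third_deg_zero]
    refine (congrArg (fun z => Abelian.Ext.comp ((y.mapExactFunctor F).mapExactFunctor G) z rfl)
      nat).trans ?_
    rw [← Abelian.Ext.comp_assoc_of_second_deg_zero]
    refine (congrArg (fun z => Abelian.Ext.comp z _ rfl) (ih y)).trans ?_
    exact Abelian.Ext.comp_assoc _ _ _ _ _ (by omega)

end MapExact

/-! ### Change of base ring -/

section Map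

variable {A B C : Type u} [CommRing A] [CommRing B] [CommRing C]

/-- The canonical map `H^i_J(M) → H^i_I(M)` for `φ : A → B`, `φ(I) ⊆ J` and a `B`-module `M`. -/
def H.res (φ : A →+* B) {I : Ideal A} {J : Ideal B} (h : I ≤ J.comap φ) (i : ℕ)
    (M : ModuleCat.{u} B) : H J i M →+ H I i ((ModuleCat.restrictScalars φ).obj M) :=
  H.map φ h i (𝟙 _)

variable (φ : A →+* B) {I : Ideal A} {J : Ideal B} (h : I ≤ J.comap φ)

lemma H.res_of {i : ℕ} {M : ModuleCat.{u} B} (t : ℕ) (x : extQuot J M i t) :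
    H.res φ h i M (H.of J i M t x) = H.of I i _ t ((Abelian.Ext.mk₀ (quotPowChange φ h t)).comp
      (x.mapExactFunctor (ModuleCat.restrictScalars φ)) (zero_add i)) := by
  rw [H.res, H.map_of, extChange, Abelian.Ext.comp_mk₀_id]

lemma H.map_eq_push_res {i : ℕ} {M : ModuleCat.{u} B} {N : ModuleCat.{u} A}
    (ψ : (ModuleCat.restrictScalars φ).obj M ⟶ N) (x : H J i M) :
    H.map φ h i ψ x = H.push i ψ (H.res φ h i M x) := by
  obtain ⟨t, x, rfl⟩ := H.exists_of x
  rw [H.res_of, H.push, H.postcomp_of, H.map_of, extChange]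

/-- Restriction of scalars is exact, so it respects Yoneda products. Taking β of degree zero or an
extension class gives compatibility with induced maps and with connecting homomorphisms. -/
lemma H.res_postcomp {M N : ModuleCat.{u} B} {b i j : ℕ} (β : Abelian.Ext.{u} M N b)
    (hij : i + b = j) (x : H J i M) :
    H.res φ h j N (H.postcomp β hij x) =
      H.postcomp (β.mapExactFunctor (ModuleCat.restrictScalars φ)) hij (H.res φ h i M x) := by
  obtain ⟨t, x, rfl⟩ := H.exists_of x
  rw [H.res_of, H.postcomp_of, H.postcomp_of, H.res_of, Abelian.Ext.mapExactFunctor_comp]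
  congr 1
  exact (Abelian.Ext.comp_assoc _ _ _ _ _ (by omega)).symm

lemma H.res_push {M N : ModuleCat.{u} B} {i : ℕ} (f : M ⟶ N) (x : H J i M) :
    H.res φ h i N (H.push i f x) =
      H.push i ((ModuleCat.restrictScalars φ).map f) (H.res φ h i M x) := by
  rw [H.push, H.res_postcomp, Abelian.Ext.mapExactFunctor_mk₀, H.push]

lemma H.res_connecting {S : ShortComplex (ModuleCat.{u} B)} (hS : S.ShortExact) {i : ℕ}
    (x : H J i S.X₃) :
    H.res φ h (i + 1) S.X₁ (H.connecting hS i x) =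
      H.connecting (hS.map_of_exact (ModuleCat.restrictScalars φ)) i (H.res φ h i S.X₃ x) := by
  rw [H.connecting, H.res_postcomp, Abelian.Ext.mapExactFunctor_extClass, H.connecting]
  rfl

/-- Restriction along `φ` is invariant under automorphisms `σ` of `B` over `A`, up to the
identification `τ` of `M` with its twist by `σ`. -/
lemma H.res_res (σ : B →+* B) (hσ : J ≤ J.comap σ)
    (τ : ModuleCat.restrictScalars.{u} σ ⋙ ModuleCat.restrictScalars φ ⟶
      ModuleCat.restrictScalars φ)
    (hτ : ∀ t, quotPowChange φ h t ≫ (ModuleCat.restrictScalars φ).map (quotPowChange σ hσ t) ≫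
      τ.app _ = quotPowChange φ h t)
    {i : ℕ} {M : ModuleCat.{u} B} (x : H J i M) :
    H.push i (τ.app M) (H.res φ h i _ (H.res σ hσ i M x)) = H.res φ h i M x := by
  obtain ⟨t, x, rfl⟩ := H.exists_of x
  rw [H.res_of, H.res_of, H.res_of, H.push]
  refine (H.postcomp_of (Abelian.Ext.mk₀ (τ.app M)) (add_zero i) t _).trans ?_
  congr 1
  rw [Abelian.Ext.mapExactFunctor_comp, Abelian.Ext.mapExactFunctor_mk₀,
    Abelian.Ext.mk₀_comp_mk₀_assoc, Abelian.Ext.comp_assoc_of_third_deg_zero]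
  refine (congrArg (fun z => Abelian.Ext.comp (Abelian.Ext.mk₀ _) z (zero_add i))
    (mapExactFunctor_naturality _ _ _ τ x)).trans ?_
  rw [Abelian.Ext.mk₀_comp_mk₀_assoc, Category.assoc, hτ t]

end Map

/-! ### Degree zero: elements killed by a power of the ideal -/

section DegreeZero

variable {A : Type u} [CommRing A] {I : Ideal A}

/-- The element of `M` that corresponds to a class in `Ext^0(A / I^t, M)`. -/
def extEval {M : ModuleCat.{u} A} {t : ℕ} (x : extQuot I M 0 t) : M :=
  (Abelian.Ext.homEquiv₀ x).hom (Submodule.Quotient.mk (1 : A) : A ⧸ I ^ t)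

lemma extEval_mk₀ {M : ModuleCat.{u} A} {t : ℕ} (f : quotPow I t ⟶ M) :
    extEval (I := I) (Abelian.Ext.mk₀ f) = f.hom (Submodule.Quotient.mk (1 : A) : A ⧸ I ^ t) := by
  have : Abelian.Ext.homEquiv₀ (Abelian.Ext.mk₀ f) = f := Abelian.Ext.homEquiv₀.right_inv f
  rw [extEval, this]

lemma extEval_injective {M : ModuleCat.{u} A} {t : ℕ} :
    Function.Injective (extEval (I := I) (M := M) (t := t)) := by
  intro x y hxy
  obtain ⟨f, rfl⟩ := (Abelian.Ext.mk₀_bijective _ _).2 x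
  obtain ⟨g, rfl⟩ := (Abelian.Ext.mk₀_bijective _ _).2 y
  rw [extEval_mk₀, extEval_mk₀] at hxy
  congr 1
  apply ModuleCat.hom_ext
  apply Submodule.linearMap_qext
  apply LinearMap.ext_ring
  exact hxy

/-- The map `H^0_I(M) → M`. -/
def H.eval (I : Ideal A) (M : ModuleCat.{u} A) : H I 0 M → M :=
  DirectLimit.lift (extTransition I M 0) (fun _ x => extEval x) (fun t t' ht x => by
    obtain ⟨f, rfl⟩ := (Abelian.Ext.mk₀_bijective _ _).2 x
    rw [extTransition_apply, Abelian.Ext.mk₀_comp_mk₀, extEval_mk₀, extEval_mk₀]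
    rfl)

lemma H.eval_of_mk₀ {M : ModuleCat.{u} A} {t : ℕ} (f : quotPow I t ⟶ M) :
    H.eval I M (H.of I 0 M t (Abelian.Ext.mk₀ f)) =
      f.hom (Submodule.Quotient.mk (1 : A) : A ⧸ I ^ t) := extEval_mk₀ f

lemma H.eval_injective (M : ModuleCat.{u} A) : Function.Injective (H.eval I M) := by
  intro x y hxy
  induction x, y using DirectLimit.induction₂ with | _ t x y
  exact congrArg (H.of I 0 M t) (extEval_injective hxy)

/-- A map A / I^t → M is determined by the image of 1, which can be any element annihilated by I^t.
-/
lemma H.exists_eval_eq_iff (M : ModuleCat.{u} A) (m : M) :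
    (∃ x, H.eval I M x = m) ↔ ∃ t, ∀ a ∈ I ^ t, a • m = 0 := by
  constructor
  · rintro ⟨x, rfl⟩
    obtain ⟨t, x, rfl⟩ := H.exists_of x
    obtain ⟨f, rfl⟩ := (Abelian.Ext.mk₀_bijective _ _).2 x
    refine ⟨t, fun a ha => ?_⟩
    rw [H.eval_of_mk₀, ← _root_.map_smul, ← Submodule.Quotient.mk_smul, smul_eq_mul, mul_one,
      (Submodule.Quotient.mk_eq_zero _).2 ha, map_zero]
  · rintro ⟨t, ht⟩
    let f : quotPow I t ⟶ M := ModuleCat.ofHom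
      ((I ^ t).liftQ (LinearMap.toSpanSingleton A M m) fun a ha => ht a ha)
    refine ⟨H.of I 0 M t (Abelian.Ext.mk₀ f), ?_⟩
    rw [H.eval_of_mk₀]
    exact one_smul A m

lemma H.eval_push {M N : ModuleCat.{u} A} (f : M ⟶ N) (x : H I 0 M) :
    H.eval I N (H.push 0 f x) = f.hom (H.eval I M x) := by
  obtain ⟨t, x, rfl⟩ := H.exists_of x
  obtain ⟨g, rfl⟩ := (Abelian.Ext.mk₀_bijective _ _).2 x
  rw [H.push, H.postcomp_of, Abelian.Ext.mk₀_comp_mk₀, H.eval_of_mk₀, H.eval_of_mk₀]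
  rfl

lemma H.eval_res {B : Type u} [CommRing B] (φ : A →+* B) {J : Ideal B} (h : I ≤ J.comap φ)
    {M : ModuleCat.{u} B} (x : H J 0 M) :
    H.eval I ((ModuleCat.restrictScalars φ).obj M) (H.res φ h 0 M x) = H.eval J M x := by
  obtain ⟨t, x, rfl⟩ := H.exists_of x
  obtain ⟨g, rfl⟩ := (Abelian.Ext.mk₀_bijective _ _).2 x
  rw [H.res_of, Abelian.Ext.mapExactFunctor_mk₀, Abelian.Ext.mk₀_comp_mk₀, H.eval_of_mk₀,
    H.eval_of_mk₀]
  change g.hom (Ideal.Quotient.mk (J ^ t) (φ 1)) = g.hom (Ideal.Quotient.mk (J ^ t) 1)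
  rw [map_one]

end DegreeZero

/-! ### Torsion modules and vanishing theorems -/

section Torsion

variable {A : Type u} [CommRing A]

/-- Every element of `M` is killed by a power of every element of `s`. -/
def IsTors (s : Set A) (M : Type*) [AddCommGroup M] [Module A M] : Prop :=
  ∀ a ∈ s, ∀ x : M, ∃ k : ℕ, a ^ k • x = 0

section

variable {M N : Type*} [AddCommGroup M] [Module A M] [AddCommGroup N] [Module A N]

lemma IsTors.of_injective {s : Set A} (h : IsTors s N) (f : M →ₗ[A] N)
    (hf : Function.Injective f) : IsTors s M := fun a ha x => by
  obtain ⟨k, hk⟩ := h a ha (f x)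
  exact ⟨k, hf (by rw [map_smul, hk, map_zero])⟩

lemma IsTors.of_surjective {s : Set A} (h : IsTors s M) (f : M →ₗ[A] N)
    (hf : Function.Surjective f) : IsTors s N := fun a ha x => by
  obtain ⟨x, rfl⟩ := hf x
  obtain ⟨k, hk⟩ := h a ha x
  exact ⟨k, by rw [← map_smul, hk, map_zero]⟩

lemma mem_radical_torsionOf {a : A} {x : M} :
    a ∈ (Ideal.torsionOf A M x).radical ↔ ∃ k : ℕ, a ^ k • x = 0 := by
  simp [Ideal.mem_radical_iff]

/-- Radicals are ideals, so in this form torsion need only be checked on generators, and finite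
generation yields a uniform power. -/
lemma isTors_iff_le_radical {s : Set A} :
    IsTors s M ↔ ∀ x : M, s ⊆ (Ideal.torsionOf A M x).radical :=
  ⟨fun h x a ha => mem_radical_torsionOf.2 (h a ha x),
    fun h _ ha x => mem_radical_torsionOf.1 (h x ha)⟩

lemma IsTors.span {s : Set A} (h : IsTors s M) : IsTors (Ideal.span s : Set A) M :=
  isTors_iff_le_radical.2 fun x => Ideal.span_le.2 (isTors_iff_le_radical.1 h x)

lemma IsTors.union {s t : Set A} (h : IsTors s M) (h' : IsTors t M) : IsTors (s ∪ t) M :=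
  fun a ha x => ha.elim (h a · x) (h' a · x)

lemma IsTors.mono {s t : Set A} (h : IsTors t M) (hst : s ⊆ t) : IsTors s M :=
  fun a ha => h a (hst ha)

lemma IsTors.exists_pow [IsNoetherianRing A] {J : Ideal A} (h : IsTors (J : Set A) M) (x : M) :
    ∃ k : ℕ, ∀ a ∈ J ^ k, a • x = 0 :=
  (Ideal.exists_pow_le_of_le_radical_of_fg (isTors_iff_le_radical.1 h x)
    (IsNoetherian.noetherian J)).imp fun _ hk a ha => (Ideal.mem_torsionOf_iff x a).1 (hk ha)

lemma IsTors.localizedModule {s : Set A} (h : IsTors s M) (S : Submonoid A) :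
    IsTors s (LocalizedModule S M) := fun a ha x => by
  induction x using LocalizedModule.induction_on with | _ m t
  obtain ⟨k, hk⟩ := h a ha m
  exact ⟨k, by rw [LocalizedModule.smul'_mk, hk, LocalizedModule.zero_mk]⟩

/-- The submodule of the elements killed by a power of each element of `s`. -/
def tors (s : Set A) (M : Type*) [AddCommGroup M] [Module A M] : Submodule A M where
  carrier := {x | s ⊆ (Ideal.torsionOf A M x).radical}
  add_mem' hx hy _ ha := by
    obtain ⟨k, hk⟩ := mem_radical_torsionOf.1 (hx ha)
    obtain ⟨l, hl⟩ := mem_radical_torsionOf.1 (hy ha)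
    refine mem_radical_torsionOf.2 ⟨k + l, ?_⟩
    rw [smul_add, pow_add, mul_smul, smul_comm, hk, mul_smul, hl, smul_zero, smul_zero, add_zero]
  zero_mem' a _ := mem_radical_torsionOf.2 ⟨0, smul_zero _⟩
  smul_mem' c x hx a ha := by
    obtain ⟨k, hk⟩ := mem_radical_torsionOf.1 (hx ha)
    exact mem_radical_torsionOf.2 ⟨k, by rw [smul_comm, hk, smul_zero]⟩

lemma mem_tors {s : Set A} {x : M} : x ∈ tors s M ↔ ∀ a ∈ s, ∃ k : ℕ, a ^ k • x = 0 :=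
  forall₂_congr fun _ _ => mem_radical_torsionOf

lemma isTors_tors (s : Set A) : IsTors s (tors s M) := fun a ha x =>
  (mem_tors.1 x.2 a ha).imp fun _ hk => Subtype.ext hk

end

/-- Over a noetherian ring, the torsion submodule of an injective module is injective. -/
lemma injective_tors [IsNoetherianRing A] (J : Ideal A) (E : Type u) [AddCommGroup E]
    [Module A E] [Module.Injective A E] : Module.Injective A (tors (J : Set A) E) := by
  refine Module.Baer.injective fun 𝔟 f => ?_
  -- As 𝔟 is finitely generated, one power of J kills the whole image of f.
  obtain ⟨s, hs⟩ : ∃ s : ℕ, ∀ a ∈ J ^ s, ∀ x, a • f x = 0 := by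
    obtain ⟨S, hS⟩ := (Module.Finite.fg_top : (⊤ : Submodule A 𝔟).FG)
    choose k hk using fun x : 𝔟 => (isTors_tors (M := E) (J : Set A)).exists_pow (f x)
    refine ⟨S.sup k, fun a ha x => ?_⟩
    have hx : x ∈ Submodule.span A (S : Set 𝔟) := hS ▸ Submodule.mem_top
    induction hx using Submodule.span_induction with
    | mem x hx => exact hk x a (Ideal.pow_le_pow_right (Finset.le_sup hx) ha)
    | zero => rw [map_zero, smul_zero]
    | add x y _ _ h h' => rw [map_add, smul_add, h, h', add_zero]
    | smul c x _ h => rw [map_smul, smul_comm, h, smul_zero]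
  -- Artin–Rees: J^(s+k) ∩ 𝔟 ⊆ J^s 𝔟, which f kills. So f factors through the image of 𝔟 in A /
  -- J^(s+k), and extensions from there to E have torsion values.
  obtain ⟨k, hk⟩ := Ideal.exists_pow_inf_eq_pow_smul J (M := A) 𝔟
  have hker : ∀ x : 𝔟, (x : A) ∈ J ^ (s + k) → f x = 0 := by
    intro x hx
    have h1 : (x : A) ∈ J ^ s • 𝔟 := by
      have : (x : A) ∈ J ^ (s + k) • (⊤ : Ideal A) ⊓ 𝔟 :=
        ⟨by rwa [smul_eq_mul, Ideal.mul_top], x.2⟩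
      rw [hk (s + k) (Nat.le_add_left _ _), Nat.add_sub_cancel] at this
      exact Submodule.smul_mono le_rfl inf_le_right this
    have h2 : ∀ y (hy : y ∈ J ^ s • 𝔟), ∃ hb : y ∈ 𝔟, f ⟨y, hb⟩ = 0 := by
      intro y hy
      induction hy using Submodule.smul_induction_on' with
      | smul a ha y hy =>
        exact ⟨𝔟.mul_mem_left a hy, (map_smul f a ⟨y, hy⟩).trans (hs a ha _)⟩
      | add y _ z _ h h' =>
        obtain ⟨hb, h⟩ := h
        obtain ⟨hb', h'⟩ := h'
        exact ⟨add_mem hb hb', (map_add f ⟨y, hb⟩ ⟨z, hb'⟩).trans (by rw [h, h', add_zero])⟩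
    exact (h2 x h1).2
  let π : 𝔟 →ₗ[A] A ⧸ J ^ (s + k) := (J ^ (s + k)).mkQ ∘ₗ 𝔟.subtype
  have hπ : LinearMap.ker π ≤ LinearMap.ker ((tors (J : Set A) E).subtype ∘ₗ f) := by
    intro x hx
    have : (x : A) ∈ J ^ (s + k) := (Submodule.Quotient.mk_eq_zero _).1 hx
    rw [LinearMap.mem_ker, LinearMap.comp_apply, hker x this, map_zero]
  obtain ⟨g, hg⟩ := Module.Injective.extension_property A E _ _
    ((LinearMap.ker π).liftQ π le_rfl)
    (LinearMap.ker_eq_bot.1 (Submodule.ker_liftQ_eq_bot _ _ _ le_rfl))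
    ((LinearMap.ker π).liftQ _ hπ)
  refine ⟨(g ∘ₗ (J ^ (s + k)).mkQ).codRestrict _ fun x => mem_tors.2 fun a ha => ⟨s + k, ?_⟩, ?_⟩
  · rw [← map_smul, LinearMap.comp_apply, Submodule.mkQ_apply, (Submodule.Quotient.mk_eq_zero _).2,
      map_zero]
    exact Ideal.mul_mem_right _ _ (Ideal.pow_mem_pow ha _)
  · intro x hx
    apply Subtype.ext
    exact LinearMap.congr_fun hg (Submodule.Quotient.mk ⟨x, hx⟩)

lemma shortExact_of_exact {M N P : ModuleCat.{u} A} (f : M ⟶ N) (g : N ⟶ P)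
    (hf : Function.Injective f.hom) (hg : Function.Surjective g.hom)
    (h : Function.Exact f.hom g.hom) :
    (ShortComplex.mk f g (ModuleCat.hom_ext h.linearMap_comp_eq_zero)).ShortExact where
  exact := (ShortComplex.ShortExact.moduleCat_exact_iff_function_exact _).2 h
  mono_f := (ModuleCat.mono_iff_injective _).2 hf
  epi_g := (ModuleCat.epi_iff_surjective _).2 hg

/-- The short exact sequence of a submodule. -/
lemma shortExact_submodule {M : ModuleCat.{u} A} (N : Submodule A M) :
    (ShortComplex.mk (ModuleCat.ofHom N.subtype : ModuleCat.of A N ⟶ M)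
      (ModuleCat.ofHom N.mkQ : M ⟶ ModuleCat.of A (M ⧸ N))
      (ModuleCat.hom_ext (LinearMap.exact_subtype_mkQ N).linearMap_comp_eq_zero)).ShortExact :=
  shortExact_of_exact (M := ModuleCat.of A N) (N := M) (P := ModuleCat.of A (M ⧸ N))
    (ModuleCat.ofHom N.subtype) (ModuleCat.ofHom N.mkQ)
    N.subtype_injective N.mkQ_surjective (LinearMap.exact_subtype_mkQ N)

/-- The short exact sequence of an injective map. -/
lemma shortExact_cokernel {M N : ModuleCat.{u} A} (f : M ⟶ N) (hf : Function.Injective f.hom) :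
    (ShortComplex.mk f (ModuleCat.ofHom (LinearMap.range f.hom).mkQ :
        N ⟶ ModuleCat.of A (N ⧸ LinearMap.range f.hom))
      (ModuleCat.hom_ext (LinearMap.exact_map_mkQ_range f.hom).linearMap_comp_eq_zero)).ShortExact :=
  shortExact_of_exact (P := ModuleCat.of A (N ⧸ LinearMap.range f.hom)) f (ModuleCat.ofHom _)
    hf (Submodule.mkQ_surjective _) (LinearMap.exact_map_mkQ_range f.hom)

/-- The short exact sequence of a surjective map. -/
lemma shortExact_kernel {M N : ModuleCat.{u} A} (f : M ⟶ N) (hf : Function.Surjective f.hom) :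
    (ShortComplex.mk (ModuleCat.ofHom (LinearMap.ker f.hom).subtype :
        ModuleCat.of A (LinearMap.ker f.hom) ⟶ M) f
      (ModuleCat.hom_ext (LinearMap.exact_subtype_ker_map f.hom).linearMap_comp_eq_zero)).ShortExact :=
  shortExact_of_exact (M := ModuleCat.of A (LinearMap.ker f.hom)) (ModuleCat.ofHom _) f
    (Submodule.subtype_injective _) hf (LinearMap.exact_subtype_ker_map f.hom)

section Vanishing

variable [IsNoetherianRing A] {𝔫 : Ideal A} [h𝔫 : 𝔫.IsMaximal]

/-- If `J` is `𝔫`-primary near `𝔫`, then `J`-torsion modules have no higher local cohomology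
at `𝔫`. -/
lemma H.subsingleton_of_isTors {J : Ideal A} {b : A} (hb : b ∉ 𝔫) {k : ℕ}
    (hJ : ∀ c ∈ 𝔫 ^ k, c * b ∈ J) (M : ModuleCat.{u} A) (hM : IsTors (J : Set A) M) (i : ℕ) :
    Subsingleton (H 𝔫 (i + 1) M) := by
  have hE : Module.Injective A (Injective.under M : ModuleCat.{u} A) :=
    (Module.injective_iff_injective_object A _).2 (inferInstanceAs (Injective (Injective.under M)))
  -- M embeds in the injective module T, and the cokernel is again J-torsion, so degrees above one
  -- shift down.
  let T : ModuleCat.{u} A := ModuleCat.of A (tors (J : Set A) (Injective.under M : ModuleCat.{u} A))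
  have hT : Injective T := (Module.injective_iff_injective_object A _).1 (injective_tors J _)
  have hι : Function.Injective (Injective.ι M).hom :=
    (ModuleCat.mono_iff_injective _).1 inferInstance
  let j : M ⟶ T := ModuleCat.ofHom ((Injective.ι M).hom.codRestrict _ fun x => mem_tors.2
    fun a ha => (hM a ha x).imp fun _ hk => by rw [← _root_.map_smul, hk, map_zero])
  have hj : Function.Injective j.hom := fun x y hxy => hι (congrArg Subtype.val hxy)
  have hS := shortExact_cokernel j hj
  have hQ : IsTors (J : Set A) (T ⧸ LinearMap.range j.hom) :=
    (isTors_tors (J : Set A)).of_surjective _ (Submodule.mkQ_surjective _)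
  cases i with
  | succ i =>
    exact H.subsingleton_left hS (H.subsingleton_of_isTors hb hJ _ hQ i)
      (H.subsingleton_of_injective T _)
  | zero =>
    refine subsingleton_of_forall_eq 0 fun x => ?_
    have : Subsingleton (H 𝔫 1 T) := H.subsingleton_of_injective T 0
    obtain ⟨y, rfl⟩ := H.exists_connecting_eq hS x (Subsingleton.elim _ _)
    -- In degree one it remains to lift 𝔫-power torsion elements of the cokernel to such elements of
    -- T.
    suffices ∃ z, H.push 0 (ModuleCat.ofHom (LinearMap.range j.hom).mkQ) z = y by
      obtain ⟨z, rfl⟩ := this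
      exact H.connecting_push hS z
    obtain ⟨t, ht⟩ := (H.exists_eval_eq_iff _ _).1 ⟨y, rfl⟩
    obtain ⟨x₀, hx₀⟩ := Submodule.mkQ_surjective _ (H.eval 𝔫 _ y)
    obtain ⟨s, hs⟩ := (isTors_tors (J : Set A)).exists_pow x₀
    -- Write 1 = u + c b^s with u ∈ 𝔫^t. Then c b^s x₀ has the class of x₀, as u kills that class,
    -- and 𝔫^(ks) kills it, as 𝔫^(ks) b^s ⊆ J^s.
    have hcop : IsCoprime (𝔫 ^ t) (Ideal.span {b} ^ s) := by
      refine IsCoprime.pow (Ideal.isCoprime_iff_sup_eq.2 (h𝔫.out.2 _ (left_lt_sup.2 fun h => hb ?_)))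
      exact h (Ideal.mem_span_singleton_self b)
    obtain ⟨u, hu, v, hv, huv⟩ := Ideal.isCoprime_iff_exists.1 hcop
    rw [Ideal.span_singleton_pow, Ideal.mem_span_singleton'] at hv
    obtain ⟨c, rfl⟩ := hv
    obtain ⟨z, hz⟩ := (H.exists_eval_eq_iff (I := 𝔫) T ((c * b ^ s) • x₀)).2 ⟨k * s, fun d hd => by
      have : d * b ^ s ∈ J ^ s := by
        have h1 : 𝔫 ^ k * Ideal.span {b} ≤ J := by
          rw [Ideal.mul_le]
          intro r hr y hy
          obtain ⟨w, rfl⟩ := Ideal.mem_span_singleton'.1 hy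
          rw [mul_left_comm]
          exact J.mul_mem_left _ (hJ r hr)
        have h2 := Ideal.pow_right_mono h1 s
        rw [mul_pow, ← pow_mul] at h2
        exact h2 (Ideal.mul_mem_mul hd (Ideal.pow_mem_pow (Ideal.mem_span_singleton_self b) s))
      rw [smul_smul, mul_left_comm, mul_smul]
      exact (congrArg (c • ·) (hs _ this)).trans (smul_zero c)⟩
    refine ⟨z, H.eval_injective _ ?_⟩
    rw [H.eval_push, hz]
    have e : c * b ^ s = 1 - u := by rw [← huv]; ring
    rw [e, sub_smul, one_smul, map_sub, _root_.map_smul]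
    change Submodule.mkQ _ x₀ - u • Submodule.mkQ _ x₀ = _
    rw [hx₀, ht u hu, sub_zero]

/-- Vanishing of local cohomology above the dimension: if the ideal generated by `𝔞` and `y` is
`𝔫`-primary near `𝔫`, then the local cohomology of an `𝔞`-torsion module vanishes above the
number of elements of `y`. -/
lemma H.subsingleton_of_card_lt {𝔞 : Ideal A} {y : Finset A} (hy : (y : Set A) ⊆ 𝔫) {b : A}
    (hb : b ∉ 𝔫) {k : ℕ} (hJ : ∀ c ∈ 𝔫 ^ k, c * b ∈ 𝔞 ⊔ Ideal.span (y : Set A))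
    (M : ModuleCat.{u} A) (hM : IsTors (𝔞 : Set A) M) {i : ℕ} (hi : y.card < i) :
    Subsingleton (H 𝔫 i M) := by
  classical
  -- Here T collects the elements of y not yet known to act with torsion; only they count towards
  -- the bound.
  suffices ∀ T : Finset A, T ⊆ y → ∀ M : ModuleCat.{u} A,
      IsTors ((𝔞 : Set A) ∪ (y \ T : Set A)) M → ∀ i, T.card < i → Subsingleton (H 𝔫 i M) from
    this y subset_rfl M (by simpa using hM) i hi
  intro T
  induction T using Finset.induction with
  | empty =>
    intro _ M hM i hi
    obtain ⟨i, rfl⟩ := Nat.exists_eq_succ_of_ne_zero hi.ne'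
    refine H.subsingleton_of_isTors hb hJ M ?_ i
    have := hM.span
    rwa [Ideal.span_union, Ideal.span_eq, Finset.coe_empty, Set.sdiff_empty] at this
  | insert f T hfT ih =>
    intro hT M hM i hi
    rw [Finset.card_insert_of_notMem hfT] at hi
    have hTy : T ⊆ y := (Finset.subset_insert f T).trans hT
    have hf : f ∈ 𝔫 := hy (hT (Finset.mem_insert_self f T))
    have key : ∀ {N : Type u} [AddCommGroup N] [Module A N],
        IsTors ((𝔞 : Set A) ∪ (y \ (insert f T : Finset A) : Set A)) N → IsTors {f} N →
        IsTors ((𝔞 : Set A) ∪ (y \ T : Set A)) N := by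
      intro N _ _ h h'
      refine (h.union h').mono ?_
      intro a ha
      by_cases haf : a = f
      · exact Or.inr haf
      · simpa [haf] using ha
    -- All local cohomology of M_f vanishes. The kernel and cokernel of M → M_f are f-torsion, so
    -- induction applies to them; the cokernel enters one degree lower, which matches the smaller T.
    let S := Submonoid.powers f
    let L : ModuleCat.{u} A := ModuleCat.of A (LocalizedModule S M)
    let ℓ : M →ₗ[A] LocalizedModule S M := LocalizedModule.mkLinearMap S M
    let R : ModuleCat.{u} A := ModuleCat.of A (LinearMap.range ℓ)
    have h₁ := shortExact_kernel (M := M) (N := R) (ModuleCat.ofHom ℓ.rangeRestrict)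
      ℓ.surjective_rangeRestrict
    have h₂ := shortExact_submodule (M := L) (LinearMap.range ℓ)
    have hL : ∀ i, Subsingleton (H 𝔫 i L) := by
      refine H.subsingleton_of_bijective hf L ?_
      exact (Module.End.isUnit_iff _).1
        (IsLocalizedModule.map_units ℓ (⟨f, Submonoid.mem_powers f⟩ : S))
    refine H.subsingleton_of_ends h₁ (ih hTy _ (key (hM.of_injective _
      (Submodule.subtype_injective _)) ?_) i (by omega)) ?_
    · rintro _ rfl x
      have hx : ℓ x.1 = 0 := congrArg Subtype.val x.2
      obtain ⟨⟨_, k, rfl⟩, hc⟩ := (IsLocalizedModule.eq_zero_iff S ℓ).1 hx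
      exact ⟨k, Subtype.ext hc⟩
    · obtain ⟨i, rfl⟩ := Nat.exists_eq_succ_of_ne_zero (Nat.ne_zero_of_lt hi)
      refine H.subsingleton_left h₂ (ih hTy _ (key ((hM.localizedModule S).of_surjective _
        (Submodule.mkQ_surjective _)) ?_) i (by omega)) (hL _)
      rintro _ rfl x
      obtain ⟨x, rfl⟩ := Submodule.mkQ_surjective _ x
      obtain ⟨⟨m, ⟨_, k, rfl⟩⟩, hx⟩ := IsLocalizedModule.surj S ℓ x
      refine ⟨k, ?_⟩
      rw [← _root_.map_smul, Submodule.mkQ_apply, Submodule.Quotient.mk_eq_zero]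
      exact ⟨m, hx.symm⟩

end Vanishing

end Torsion

/-! ### Independence of the base ring -/

section Comparison

variable {A B : Type u} [CommRing A] [CommRing B] (φ : A →+* B)

lemma mem_tors_span_singleton {M : Type*} [AddCommGroup M] [Module A M] {f : A} {x : M} :
    x ∈ tors (Ideal.span {f} : Set A) M ↔ ∃ k : ℕ, f ^ k • x = 0 := by
  refine ⟨fun h => mem_tors.1 h f (Ideal.mem_span_singleton_self f), fun h => ?_⟩
  have : (Ideal.span {f} : Ideal A) ≤ (Ideal.torsionOf A M x).radical :=
    (Ideal.span_singleton_le_iff_mem _).2 (mem_radical_torsionOf.2 h)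
  exact this

/-- Injective modules are divisible. -/
lemma smul_surjective_of_injective [IsDomain B] (E : Type u) [AddCommGroup E] [Module B E]
    [Module.Injective B E] {b : B} (hb : b ≠ 0) : Function.Surjective fun x : E => b • x := by
  intro x
  obtain ⟨g, hg⟩ := Module.Injective.extension_property B E B B (LinearMap.mulLeft B b)
    (mul_right_injective₀ hb) (LinearMap.toSpanSingleton B E x)
  refine ⟨g 1, ?_⟩
  have := LinearMap.congr_fun hg 1
  simp only [LinearMap.comp_apply, LinearMap.mulLeft_apply, LinearMap.toSpanSingleton_apply,
    one_smul, mul_one] at this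
  change b • g 1 = x
  rw [← map_smul, smul_eq_mul, mul_one, this]

variable [IsNoetherianRing A] [IsNoetherianRing B] [IsDomain B] {𝔫 : Ideal A} [h𝔫 : 𝔫.IsMaximal]

/-- Injective modules over a noetherian `A`-algebra that is a domain are acyclic for the local
cohomology over `A`. -/
lemma H.subsingleton_restrictScalars_of_injective (E : ModuleCat.{u} B) [Injective E] (i : ℕ) :
    Subsingleton (H 𝔫 (i + 1) ((ModuleCat.restrictScalars φ).obj E)) := by
  classical
  obtain ⟨F, hF⟩ := IsNoetherian.noetherian 𝔫
  -- Induction on the generators of 𝔫 not known to act with torsion on E. Once none is left, E is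
  -- 𝔫-torsion over A.
  suffices ∀ T : Finset A, T ⊆ F → ∀ E : ModuleCat.{u} B, Injective E →
      IsTors (φ '' (F \ T : Set A)) E →
      Subsingleton (H 𝔫 (i + 1) ((ModuleCat.restrictScalars φ).obj E)) from
    this F subset_rfl E inferInstance (fun _ ⟨_, hx, _⟩ => absurd hx.1 hx.2)
  intro T
  induction T using Finset.induction with
  | empty =>
    intro _ E _ hE
    refine H.subsingleton_of_isTors (J := 𝔫) (b := 1) (k := 1)
      (fun h => h𝔫.ne_top (𝔫.eq_top_iff_one.2 h)) (by simp) _ ?_ i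
    rw [← hF]
    refine IsTors.span fun a ha x => ?_
    obtain ⟨k, hk⟩ := hE (φ a) ⟨a, by simpa using ha, rfl⟩ x
    exact ⟨k, by rwa [← map_pow] at hk⟩
  | insert f T hfT ih =>
    intro hT E hE htors
    have hTF : T ⊆ F := (Finset.subset_insert f T).trans hT
    have hf : f ∈ 𝔫 := hF ▸ Submodule.subset_span (hT (Finset.mem_insert_self f T))
    have hEm : Module.Injective B E := (Module.injective_iff_injective_object B _).2 hE
    let E' : Submodule B E := tors (Ideal.span {φ f} : Set B) E
    have hS := (shortExact_submodule (M := E) E').map_of_exact (ModuleCat.restrictScalars φ)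
    have hE' : Injective (ModuleCat.of B E') :=
      (Module.injective_iff_injective_object B _).1 (injective_tors _ E)
    refine H.subsingleton_of_ends hS (ih hTF _ hE' ?_) ?_
    · have h₁ : IsTors (φ '' (F \ (insert f T : Finset A) : Set A)) E' :=
        htors.of_injective E'.subtype E'.subtype_injective
      have h₂ : IsTors {φ f} E' := (isTors_tors (M := E) (Ideal.span {φ f} : Set B)).mono
        (Set.singleton_subset_iff.2 (Ideal.mem_span_singleton_self _))
      refine (h₁.union h₂).mono ?_
      rintro _ ⟨a, ha, rfl⟩
      by_cases haf : a = f
      · exact Or.inr (congrArg φ haf)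
      · exact Or.inl ⟨a, by simpa [haf] using ha, rfl⟩
    -- On E / E' the action of φ f is injective because its torsion is divided out, and surjective
    -- because E is divisible; if φ f = 0, the quotient is zero.
    · refine H.subsingleton_of_bijective hf _ ?_ _
      change Function.Bijective fun x : E ⧸ E' => φ f • x
      constructor
      · refine (injective_iff_map_eq_zero (DistribSMul.toAddMonoidHom (E ⧸ E') (φ f))).2 fun x hx => ?_
        obtain ⟨x, rfl⟩ := E'.mkQ_surjective x
        change φ f • E'.mkQ x = 0 at hx
        rw [← _root_.map_smul, Submodule.mkQ_apply, Submodule.Quotient.mk_eq_zero,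
          mem_tors_span_singleton] at hx
        obtain ⟨k, hk⟩ := hx
        rw [Submodule.mkQ_apply, Submodule.Quotient.mk_eq_zero, mem_tors_span_singleton]
        exact ⟨k + 1, by rw [pow_succ, mul_smul, hk]⟩
      · intro x
        obtain ⟨x, rfl⟩ := E'.mkQ_surjective x
        by_cases h0 : φ f = 0
        · refine ⟨0, ?_⟩
          change φ f • (0 : E ⧸ E') = _
          rw [smul_zero, eq_comm, Submodule.mkQ_apply, Submodule.Quotient.mk_eq_zero,
            mem_tors_span_singleton]
          exact ⟨1, by rw [h0, pow_one, zero_smul]⟩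
        · obtain ⟨y, rfl⟩ := smul_surjective_of_injective E h0 x
          exact ⟨E'.mkQ y, rfl⟩

/-- Independence of the base ring: local cohomology over `B` and over `A` agree on `B`-modules. -/
theorem H.res_bijective {J : Ideal B} (h : 𝔫 ≤ J.comap φ) {N : ℕ} (hJ : J ^ N ≤ 𝔫.map φ) (i : ℕ)
    (M : ModuleCat.{u} B) : Function.Bijective (H.res φ h i M) := by
  induction i generalizing M with
  | zero =>
    constructor
    · intro x y hxy
      apply H.eval_injective
      rw [← H.eval_res φ h, ← H.eval_res φ h, hxy]
    · intro y
      obtain ⟨t, ht⟩ := (H.exists_eval_eq_iff _ _).1 ⟨y, rfl⟩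
      have hker : (𝔫 ^ t).map φ ≤ Ideal.torsionOf B M (H.eval 𝔫 _ y) := by
        rw [Ideal.map_le_iff_le_comap]
        exact fun a ha => (Ideal.mem_torsionOf_iff _ _).2 (ht a ha)
      -- The exponent N * t serves because J^(N t) ⊆ (𝔫B)^t.
      obtain ⟨x, hx⟩ := (H.exists_eval_eq_iff (I := J) M (H.eval 𝔫 _ y)).2
        ⟨N * t, fun a ha => (Ideal.mem_torsionOf_iff _ _).1 (hker (by
          rw [Ideal.map_pow]
          rw [pow_mul] at ha
          exact Ideal.pow_right_mono hJ t ha))⟩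
      refine ⟨x, H.eval_injective _ ?_⟩
      rw [H.eval_res, hx]
  | succ i ih =>
    -- Dimension shift: the injective module is acyclic over B and also over A, so degree i + 1
    -- follows from degree i by a diagram chase.
    have hS := shortExact_cokernel (Injective.ι M) ((ModuleCat.mono_iff_injective _).1 inferInstance)
    have hS' := hS.map_of_exact (ModuleCat.restrictScalars φ)
    constructor
    · refine (injective_iff_map_eq_zero _).2 fun x hx => ?_
      have : Subsingleton (H J (i + 1) (Injective.under M)) := H.subsingleton_of_injective _ i
      obtain ⟨x, rfl⟩ := H.exists_connecting_eq hS x (Subsingleton.elim _ _)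
      have hx' := (H.res_connecting φ h hS x).symm.trans hx
      obtain ⟨w, hw⟩ := H.exists_push_eq_of_connecting hS' _ hx'
      obtain ⟨w, rfl⟩ := (ih (Injective.under M)).2 w
      have hw' := (H.res_push φ h _ w).trans hw
      rw [← (ih _).1 hw']
      exact H.connecting_push hS w
    · intro y
      have : Subsingleton (H 𝔫 (i + 1) ((ModuleCat.restrictScalars φ).obj (Injective.under M))) :=
        H.subsingleton_restrictScalars_of_injective φ _ i
      obtain ⟨y, rfl⟩ := H.exists_connecting_eq hS' y (this.elim _ _)
      obtain ⟨x, hx⟩ := (ih _).2 y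
      refine ⟨H.connecting hS i x, (H.res_connecting φ h hS x).trans ?_⟩
      exact congrArg (H.connecting hS' i) hx

end Comparison

/-! ### Rank of g − 1 and dimension of fixed subspaces -/

section LinearAlgebra

open MvPolynomial

variable {K : Type u} [Field K] {n : ℕ}

/-- The image is a line spanned by some v with M v = c v. Nilpotency forces c = 0, so M kills its
own image. -/
lemma pow_two_eq_zero_of_rank_eq_one {M : Matrix (Fin n) (Fin n) K} (h : M.rank = 1)
    (hM : IsNilpotent M) : M ^ 2 = 0 := by
  obtain ⟨p, hp⟩ := hM
  obtain ⟨v, hv, hspan⟩ := finrank_eq_one_iff'.1 h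
  have hv0 : (v : Fin n → K) ≠ 0 := fun h0 => hv (Subtype.ext h0)
  obtain ⟨c, hc⟩ := hspan ⟨M.mulVecLin v, ⟨_, rfl⟩⟩
  have hc : c • (v : Fin n → K) = M.mulVec v := congrArg Subtype.val hc
  have hpow : ∀ k : ℕ, (M ^ k).mulVec v = c ^ k • (v : Fin n → K) := by
    intro k
    induction k with
    | zero => simp
    | succ k ih => rw [pow_succ, ← Matrix.mulVec_mulVec, ← hc, Matrix.mulVec_smul, ih, smul_smul,
        pow_succ, mul_comm]
  have hc0 : c = 0 := by
    have := hpow p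
    rw [hp, Matrix.zero_mulVec] at this
    exact eq_zero_of_pow_eq_zero ((smul_eq_zero.1 this.symm).resolve_right hv0)
  have hMv : M.mulVec v = 0 := by rw [← hc, hc0, zero_smul]
  apply Matrix.toLin'.injective
  refine LinearMap.ext fun w => ?_
  obtain ⟨d, hd⟩ := hspan ⟨M.mulVecLin w, ⟨_, rfl⟩⟩
  have hd : d • (v : Fin n → K) = M.mulVec w := congrArg Subtype.val hd
  rw [Matrix.toLin'_apply, pow_two, ← Matrix.mulVec_mulVec, ← hd, Matrix.mulVec_smul, hMv,
    smul_zero, map_zero, LinearMap.zero_apply]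

/-- An element of order the characteristic that is not a transvection fixes a subspace of
codimension at least two. -/
lemma two_le_rank_sub_one {g : GL (Fin n) K} {p : ℕ} [hp : Fact p.Prime] [CharP K p]
    (hgp : g ^ p = 1) (hg1 : g ≠ 1) (hg : ¬ IsTransvection g) :
    2 ≤ ((g : Matrix (Fin n) (Fin n) K) - 1).rank := by
  have hn : Nonempty (Fin n) := by
    by_contra hn
    rw [not_nonempty_iff] at hn
    exact hg1 (Subsingleton.elim _ _)
  have hnil : IsNilpotent ((g : Matrix (Fin n) (Fin n) K) - 1) := by
    refine ⟨p, ?_⟩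
    -- Frobenius: (g − 1)^p = g^p − 1 in characteristic p.
    rw [sub_pow_char_of_commute p (Commute.one_right _), one_pow, ← Units.val_pow_eq_pow_val, hgp,
      Units.val_one, sub_self]
  have h0 : ((g : Matrix (Fin n) (Fin n) K) - 1).rank ≠ 0 := by
    intro h
    have hr := Submodule.finrank_eq_zero.1 h
    rw [LinearMap.range_eq_bot, ← Matrix.toLin'_apply', map_eq_zero_iff _ Matrix.toLin'.injective,
      sub_eq_zero] at hr
    exact hg1 (Units.ext hr)
  have h1 : ((g : Matrix (Fin n) (Fin n) K) - 1).rank ≠ 1 := fun h =>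
    hg ⟨h, pow_two_eq_zero_of_rank_eq_one h hnil⟩
  omega

/-- The images of the variables are algebraically independent. Transcendence degree thus takes the
place of Krull dimension in the counts below. -/
lemma le_of_injective_mvPolynomial {s d : ℕ}
    (f : MvPolynomial (Fin s) K →ₐ[K] MvPolynomial (Fin d) K) (hf : Function.Injective f) :
    s ≤ d := by
  have h : AlgebraicIndependent K fun i => f (X i) := by
    rw [AlgebraicIndependent]
    convert! hf
    ext i
    simp
  have := h.lift_cardinalMk_le_trdeg
  simpa using this

/-- The linear form with given coefficients. -/
def linearForm (K : Type u) [Field K] (n : ℕ) : (Fin n → K) →ₗ[K] MvPolynomial (Fin n) K :=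
  Fintype.linearCombination K X

lemma linearForm_apply (c : Fin n → K) : linearForm K n c = ∑ j, C (c j) * X j := by
  simp [linearForm, Fintype.linearCombination_apply, smul_eq_C_mul]

/-- The ideal generated by the linear forms `g(x) - x`. -/
def fixIdeal (g : GL (Fin n) K) : Ideal (MvPolynomial (Fin n) K) :=
  Ideal.span (Set.range fun i => act g (X i) - X i)

lemma act_X_sub_X (g : GL (Fin n) K) (i : Fin n) :
    act g (X i) - X i = linearForm K n (((g : Matrix (Fin n) (Fin n) K) - 1) i) := by
  rw [linearForm_apply, act_X]
  simp [Matrix.one_apply, sub_mul, Finset.sum_sub_distrib]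

/-- The dimension of `R / fixIdeal g` is at most `n - rank (g - 1)`. -/
lemma add_rank_le_of_injective (g : GL (Fin n) K) {s : ℕ}
    (θ : MvPolynomial (Fin s) K →ₐ[K] MvPolynomial (Fin n) K ⧸ fixIdeal g)
    (hθ : Function.Injective θ) :
    s + ((g : Matrix (Fin n) (Fin n) K) - 1).rank ≤ n := by
  -- The row space W of g − 1 gives linear forms that vanish in the quotient; a basis of a
  -- complement U supplies n − rank forms that generate it.
  let W : Submodule K (Fin n → K) :=
    Submodule.span K (Set.range ((g : Matrix (Fin n) (Fin n) K) - 1).row)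
  have hW : Module.finrank K W = ((g : Matrix (Fin n) (Fin n) K) - 1).rank :=
    (Matrix.rank_eq_finrank_span_row _).symm
  obtain ⟨U, hU⟩ := W.exists_isCompl
  have hfin := Submodule.finrank_add_eq_of_isCompl hU
  rw [Module.finrank_fin_fun, hW] at hfin
  let q := Ideal.Quotient.mkₐ K (fixIdeal g)
  let b := Module.finBasis K U
  let ψ : MvPolynomial (Fin (Module.finrank K U)) K →ₐ[K] MvPolynomial (Fin n) K ⧸ fixIdeal g :=
    aeval fun j => q (linearForm K n (b j))
  have hWq : W ≤ LinearMap.ker (q.toLinearMap ∘ₗ linearForm K n) := by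
    refine Submodule.span_le.2 ?_
    rintro _ ⟨i, rfl⟩
    refine LinearMap.mem_ker.2 (Ideal.Quotient.eq_zero_iff_mem.2 ?_)
    exact Ideal.subset_span ⟨i, act_X_sub_X g i⟩
  have hUq : U ≤ (Subalgebra.toSubmodule ψ.range).comap (q.toLinearMap ∘ₗ linearForm K n) := by
    intro u hu
    have hb : (⟨u, hu⟩ : U) ∈ Submodule.span K (Set.range b) := by
      rw [b.span_eq]; exact Submodule.mem_top
    have := Submodule.mem_map_of_mem (f := U.subtype) hb
    rw [Submodule.map_span] at this
    refine Submodule.span_le.2 ?_ this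
    rintro _ ⟨_, ⟨j, rfl⟩, rfl⟩
    exact ⟨X j, aeval_X _ _⟩
  have hψ : Function.Surjective ψ := by
    have hX : ∀ i, q (X i) ∈ ψ.range := by
      intro i
      have h1 : (Pi.single i 1 : Fin n → K) ∈ W ⊔ U := hU.sup_eq_top ▸ Submodule.mem_top
      have h2 : W ⊔ U ≤ (Subalgebra.toSubmodule ψ.range).comap (q.toLinearMap ∘ₗ linearForm K n) :=
        sup_le (fun w hw => by
          have : (q.toLinearMap ∘ₗ linearForm K n) w = 0 := hWq hw
          rw [Submodule.mem_comap, this]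
          exact zero_mem _) hUq
      have h3 : linearForm K n (Pi.single i 1) = X i := by
        simp [linearForm, Fintype.linearCombination_apply_single]
      have h4 := h2 h1
      rw [Submodule.mem_comap, LinearMap.comp_apply, h3] at h4
      exact h4
    intro y
    obtain ⟨r, rfl⟩ := Ideal.Quotient.mkₐ_surjective K (fixIdeal g) y
    have h5 : (Algebra.adjoin K (Set.range (X : Fin n → MvPolynomial (Fin n) K))).map q ≤
        ψ.range := by
      rw [AlgHom.map_adjoin]
      refine Algebra.adjoin_le ?_
      rintro _ ⟨_, ⟨i, rfl⟩, rfl⟩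
      exact hX i
    rw [adjoin_range_X] at h5
    exact h5 ⟨r, Algebra.mem_top, rfl⟩
  -- A lift of θ through ψ stays injective, so s is at most dim U.
  choose y hy using fun j => hψ (θ (X j))
  have hcomp : ψ.comp (aeval y) = θ := by
    ext j
    simp [hy]
  have := le_of_injective_mvPolynomial (aeval y)
    (Function.Injective.of_comp (f := ψ) (by rw [← AlgHom.coe_comp, hcomp]; exact hθ))
  omega

end LinearAlgebra

/-! ### The image of the transfer and inertia groups -/

section Transfer

open MvPolynomial

variable {K : Type u} [Field K] {n : ℕ} (G : Subgroup (GL (Fin n) K))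

/-- The inertia group of an ideal of `R`. -/
def inertia (P : Ideal (MvPolynomial (Fin n) K)) : Subgroup G where
  carrier := {g | ∀ r, act (g : GL (Fin n) K) r - r ∈ P}
  mul_mem' {g h} hg hh r := by
    have := P.add_mem (hh (act (g : GL (Fin n) K) r)) (hg r)
    rwa [sub_add_sub_cancel, act_act] at this
  one_mem' r := by
    have : act ((1 : G) : GL (Fin n) K) r = r := act_one r
    rw [this, sub_self]
    exact P.zero_mem
  inv_mem' {g} hg r := by
    have := P.neg_mem (hg (act ((g⁻¹ : G) : GL (Fin n) K) r))
    have h1 : act (g : GL (Fin n) K) (act ((g⁻¹ : G) : GL (Fin n) K) r) = r := by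
      rw [act_act, ← Subgroup.coe_mul, inv_mul_cancel, Subgroup.coe_one, act_one]
    rwa [h1, neg_sub] at this

variable {G} [Fintype G]

/-- If the image of the transfer is contained in a prime `P`, then the characteristic of `K`
divides the order of the inertia group of `P`. -/
lemma card_inertia_eq_zero (P : Ideal (MvPolynomial (Fin n) K)) [P.IsPrime]
    (hP : ∀ r, ∑ g : G, act (g : GL (Fin n) K) r ∈ P) : (Nat.card (inertia G P) : K) = 0 := by
  classical
  let q := Ideal.Quotient.mk P
  let π : G → (MvPolynomial (Fin n) K →* MvPolynomial (Fin n) K ⧸ P) := fun g =>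
    ((q.comp (act (g : GL (Fin n) K) : _ →+* MvPolynomial (Fin n) K) :
      MvPolynomial (Fin n) K →+* MvPolynomial (Fin n) K ⧸ P) : _ →* _)
  have hsum : ∑ g : G, (π g : MvPolynomial (Fin n) K → MvPolynomial (Fin n) K ⧸ P) = 0 := by
    funext r
    rw [Finset.sum_apply]
    change ∑ g : G, q (act (g : GL (Fin n) K) r) = 0
    rw [← map_sum]
    exact Ideal.Quotient.eq_zero_iff_mem.2 (hP r)
  -- Equal homomorphisms π g are collected, with the fibre sizes as coefficients; Dedekind's
  -- independence of characters makes these zero in R / P.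
  rw [Finset.sum_comp (fun f : MvPolynomial (Fin n) K →* MvPolynomial (Fin n) K ⧸ P =>
    (f : MvPolynomial (Fin n) K → MvPolynomial (Fin n) K ⧸ P)) π] at hsum
  have hli := linearIndependent_iff'.1 (linearIndependent_monoidHom (MvPolynomial (Fin n) K)
    (MvPolynomial (Fin n) K ⧸ P)) (Finset.univ.image π)
    (fun b => ((Finset.univ.filter fun g => π g = b).card : MvPolynomial (Fin n) K ⧸ P))
    (by simpa only [Nat.cast_smul_eq_nsmul] using hsum) (π 1)
    (Finset.mem_image_of_mem _ (Finset.mem_univ _))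
  have hcard : (Finset.univ.filter fun g => π g = π 1).card = Nat.card (inertia G P) := by
    rw [← Nat.subtype_card (p := fun g => g ∈ inertia G P)]
    intro g
    rw [Finset.mem_filter, DFunLike.ext_iff]
    simp only [Finset.mem_univ, true_and]
    refine forall_congr' fun r => ?_
    change q (act (g : GL (Fin n) K) r) = q (act ((1 : G) : GL (Fin n) K) r) ↔ _
    rw [Subgroup.coe_one, act_one, Ideal.Quotient.mk_eq_mk_iff_sub_mem]
  rw [hcard] at hli
  apply (algebraMap K (MvPolynomial (Fin n) K ⧸ P)).injective
  rw [map_natCast, hli, map_zero]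

/-- In the absence of transvections, the image of the transfer vanishes only on fixed subspaces
of codimension at least two. -/
lemma exists_fixIdeal_le (hG : ∀ g ∈ G, ¬ IsTransvection g) (P : Ideal (MvPolynomial (Fin n) K))
    [P.IsPrime] (hP : ∀ r, ∑ g : G, act (g : GL (Fin n) K) r ∈ P) :
    ∃ g : G, 2 ≤ (((g : GL (Fin n) K) : Matrix (Fin n) (Fin n) K) - 1).rank ∧
      fixIdeal (g : GL (Fin n) K) ≤ P := by
  have h0 := card_inertia_eq_zero P hP
  have hchar : CharP K (ringChar K) := ringChar.charP K
  have hdvd : ringChar K ∣ Nat.card (inertia G P) := (CharP.cast_eq_zero_iff K _ _).1 h0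
  have hp : (ringChar K).Prime := by
    refine (CharP.char_is_prime_or_zero K (ringChar K)).resolve_right fun h => ?_
    rw [h, zero_dvd_iff] at hdvd
    exact Nat.card_pos.ne' hdvd
  have : Fact (ringChar K).Prime := ⟨hp⟩
  -- Cauchy's theorem in the inertia group.
  obtain ⟨t, ht⟩ := exists_prime_orderOf_dvd_card' (ringChar K) hdvd
  have htp : ((t : G) : GL (Fin n) K) ^ ringChar K = 1 := by
    rw [← Subgroup.coe_pow, ← Subgroup.coe_pow, ← ht, pow_orderOf_eq_one, Subgroup.coe_one,
      Subgroup.coe_one]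
  have ht1 : ((t : G) : GL (Fin n) K) ≠ 1 := by
    intro h
    have : t = 1 := Subtype.ext (Subtype.ext h)
    rw [this, orderOf_one] at ht
    exact hp.one_lt.ne ht
  refine ⟨t, two_le_rank_sub_one htp ht1 (hG _ (t : G).2), Ideal.span_le.2 ?_⟩
  rintro _ ⟨i, rfl⟩
  exact t.2 (X i)

end Transfer

/-! ### Noether normalization and systems of parameters -/

section NoetherNormalization

open MvPolynomial

variable {K : Type u} [Field K] {A : Type u} [CommRing A] [Algebra K A]

/-- In an artinian quotient, some power of a maximal ideal is killed by an element outside. -/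
lemma exists_notMem_mul_mem {J 𝔫 : Ideal A} [h𝔫 : 𝔫.IsMaximal] [IsNoetherianRing A]
    [IsArtinianRing (A ⧸ J)] (hJ : J ≤ 𝔫) : ∃ b ∉ 𝔫, ∃ k : ℕ, ∀ c ∈ 𝔫 ^ k, c * b ∈ J := by
  let q := Ideal.Quotient.mk J
  let f : ℕ →o (Ideal (A ⧸ J))ᵒᵈ := ⟨fun k => OrderDual.toDual ((𝔫.map q) ^ k),
    fun _ _ h => Ideal.pow_le_pow_right h⟩
  -- The powers of the image of 𝔫 stabilize; Nakayama then gives an element congruent to 1 modulo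
  -- that image which kills the stable power.
  obtain ⟨k, hk⟩ := IsArtinian.monotone_stabilizes f
  have hk1 : (𝔫.map q) ^ k = (𝔫.map q) ^ (k + 1) := hk (k + 1) k.le_succ
  obtain ⟨r, hr, hr'⟩ := Submodule.exists_sub_one_mem_and_smul_eq_zero_of_fg_of_le_smul (𝔫.map q)
    ((𝔫.map q) ^ k) (IsNoetherian.noetherian _) (by
      rw [smul_eq_mul, ← pow_succ', ← hk1])
  obtain ⟨b, rfl⟩ := Ideal.Quotient.mk_surjective r
  refine ⟨b, fun hb => ?_, k, fun c hc => ?_⟩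
  · have h1 : b - 1 ∈ 𝔫 := by
      have : q (b - 1) ∈ 𝔫.map q := by rwa [map_sub, map_one]
      rw [← Ideal.mem_comap, Ideal.comap_map_of_surjective' q Ideal.Quotient.mk_surjective,
        Ideal.mk_ker, sup_eq_left.2 hJ] at this
      exact this
    have h2 := 𝔫.sub_mem hb h1
    rw [sub_sub_cancel] at h2
    exact h𝔫.ne_top (𝔫.eq_top_iff_one.2 h2)
  · have := hr' (q c) (by rw [← Ideal.map_pow]; exact Ideal.mem_map_of_mem q hc)
    rw [smul_eq_mul, ← map_mul, mul_comm] at this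
    exact Ideal.Quotient.eq_zero_iff_mem.1 this

/-- A system of parameters for `A / 𝔡` at a rational point, from Noether normalization. -/
lemma exists_parameters [Algebra.FiniteType K A] [IsNoetherianRing A] (ε : A →ₐ[K] K)
    (𝔡 : Ideal A) (h𝔡 : 𝔡 ≤ RingHom.ker ε) :
    ∃ (s : ℕ) (θ : MvPolynomial (Fin s) K →ₐ[K] A ⧸ 𝔡) (y : Finset A), Function.Injective θ ∧
      y.card ≤ s ∧ (y : Set A) ⊆ RingHom.ker ε ∧ ∃ b ∉ RingHom.ker ε, ∃ k : ℕ,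
        ∀ c ∈ RingHom.ker ε ^ k, c * b ∈ 𝔡 ⊔ Ideal.span (y : Set A) := by
  classical
  have hmax : (RingHom.ker ε).IsMaximal := RingHom.ker_isMaximal_of_surjective ε fun c =>
    ⟨algebraMap K A c, by rw [AlgHom.commutes]; rfl⟩
  have : Nontrivial (A ⧸ 𝔡) := Ideal.Quotient.nontrivial_iff.2 fun h =>
    hmax.ne_top (top_le_iff.1 (h ▸ h𝔡))
  obtain ⟨s, θ, hinj, hfin⟩ := exists_finite_inj_algHom_of_fg K (A ⧸ 𝔡)
  choose z hz using fun i => Ideal.Quotient.mk_surjective (θ (X i))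
  -- Lifts of the normalizing variables, translated to vanish at the rational point.
  let w : Fin s → A := fun i => z i - algebraMap K A (ε (z i))
  let y : Finset A := Finset.univ.image w
  have hyε : (y : Set A) ⊆ RingHom.ker ε := by
    intro a ha
    obtain ⟨i, -, rfl⟩ := Finset.mem_image.1 ha
    change ε (z i - algebraMap K A (ε (z i))) = 0
    rw [map_sub, AlgHom.commutes]
    exact sub_self _
  let J := 𝔡 ⊔ Ideal.span (y : Set A)
  have hJ : J ≤ RingHom.ker ε := sup_le h𝔡 (Ideal.span_le.2 hyε)
  refine ⟨s, θ, y, hinj, Finset.card_image_le.trans (by simp), hyε, ?_⟩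
  let q : A ⧸ 𝔡 →ₐ[K] A ⧸ J := Ideal.Quotient.factorₐ K le_sup_left
  have hq : q.Finite := AlgHom.Finite.of_surjective _ (Ideal.Quotient.factor_surjective le_sup_left)
  -- Modulo J the normalizing variables become constants, so A / J is finite over K, hence artinian.
  have hcomp : (Algebra.ofId K (A ⧸ J)).comp (aeval fun i => ε (z i)) = q.comp θ := by
    apply MvPolynomial.algHom_ext
    intro i
    rw [AlgHom.comp_apply, aeval_X, AlgHom.comp_apply, ← hz i]
    change algebraMap K (A ⧸ J) (ε (z i)) = Ideal.Quotient.mk J (z i)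
    rw [eq_comm, ← sub_eq_zero]
    refine Ideal.Quotient.eq_zero_iff_mem.2 (Ideal.mem_sup_right (Ideal.subset_span ?_))
    exact Finset.mem_coe.2 (Finset.mem_image_of_mem w (Finset.mem_univ i))
  have hfinJ : (Algebra.ofId K (A ⧸ J)).Finite :=
    AlgHom.Finite.of_comp_finite (hcomp ▸ hq.comp hfin)
  have : Module.Finite K (A ⧸ J) := RingHom.finite_algebraMap.1 hfinJ
  have : IsArtinianRing (A ⧸ J) := IsArtinianRing.of_finite K (A ⧸ J)
  exact exists_notMem_mul_mem hJ

end NoetherNormalization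

/-! ### The invariant ring: finiteness and vanishing -/

section Invariants

open MvPolynomial

variable {K : Type u} [Field K] {n : ℕ} (G : Subgroup (GL (Fin n) K))

lemma sub_C_mem_maxIdeal (p : MvPolynomial (Fin n) K) :
    p - C (aeval (0 : Fin n → K) p) ∈ maxIdeal K n := by
  induction p using MvPolynomial.induction_on with
  | C a => simp
  | add p q hp hq =>
    rw [map_add, C_add, add_sub_add_comm]
    exact add_mem hp hq
  | mul_X p i _ =>
    rw [map_mul, aeval_X, Pi.zero_apply, mul_zero, C_0, sub_zero]
    exact Ideal.mul_mem_left _ _ (Ideal.subset_span ⟨i, rfl⟩)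

lemma maxIdeal_eq_ker : maxIdeal K n = RingHom.ker (aeval (R := K) (0 : Fin n → K)) := by
  refine le_antisymm (Ideal.span_le.2 ?_) fun p hp => ?_
  · rintro _ ⟨i, rfl⟩
    simp [RingHom.mem_ker]
  · have := sub_C_mem_maxIdeal p
    rwa [(RingHom.mem_ker).1 hp, C_0, sub_zero] at this

/-- The augmentation of the invariant ring. -/
def augmentation : invariants G →ₐ[K] K := (aeval (0 : Fin n → K)).comp (invariants G).val

lemma invMaxIdeal_eq_ker : invMaxIdeal G = RingHom.ker (augmentation G) := by
  rw [invMaxIdeal, maxIdeal_eq_ker]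
  rfl

instance : (invMaxIdeal G).IsMaximal := by
  rw [invMaxIdeal_eq_ker]
  exact RingHom.ker_isMaximal_of_surjective _ fun c =>
    ⟨algebraMap K _ c, by rw [AlgHom.commutes]; rfl⟩

variable [Fintype G]

/-- The polynomial `∏ (T - g(r))` over the invariant ring. -/
lemma exists_orbit_polynomial (r : MvPolynomial (Fin n) K) :
    ∃ p : Polynomial (invariants G), p.Monic ∧ p.map (algebraMap _ (MvPolynomial (Fin n) K)) =
      ∏ g : G, (Polynomial.X - Polynomial.C (act (g : GL (Fin n) K) r)) := by
  let q : Polynomial (MvPolynomial (Fin n) K) :=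
    ∏ g : G, (Polynomial.X - Polynomial.C (act (g : GL (Fin n) K) r))
  have hq : q ∈ Polynomial.lifts (algebraMap (invariants G) (MvPolynomial (Fin n) K)) := by
    rw [Polynomial.lifts_iff_coeff_lifts]
    intro k
    refine ⟨⟨q.coeff k, fun h hh => ?_⟩, rfl⟩
    have hmap : q.map (act h : _ →+* MvPolynomial (Fin n) K) = q := by
      rw [Polynomial.map_prod]
      refine Fintype.prod_equiv (Equiv.mulRight (⟨h, hh⟩ : G)) _ _ fun g => ?_
      rw [Polynomial.map_sub, Polynomial.map_X, Polynomial.map_C]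
      change Polynomial.X - Polynomial.C (act h (act (g : GL (Fin n) K) r)) = _
      rw [act_act]
      rfl
    calc act h (q.coeff k) = (q.map (act h : _ →+* MvPolynomial (Fin n) K)).coeff k :=
          (Polynomial.coeff_map _ _).symm
      _ = q.coeff k := by rw [hmap]
  obtain ⟨p, hp, -, hmonic⟩ := Polynomial.lifts_and_natDegree_eq_and_monic hq
    (Polynomial.monic_prod_of_monic _ _ fun g _ => Polynomial.monic_X_sub_C _)
  exact ⟨p, hmonic, hp⟩

instance : Algebra.IsIntegral (invariants G) (MvPolynomial (Fin n) K) := ⟨fun r => by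
  obtain ⟨p, hmonic, hp⟩ := exists_orbit_polynomial G r
  refine ⟨p, hmonic, ?_⟩
  rw [Polynomial.eval₂_eq_eval_map, hp, Polynomial.eval_prod]
  refine Finset.prod_eq_zero (Finset.mem_univ (1 : G)) ?_
  rw [Polynomial.eval_sub, Polynomial.eval_X, Polynomial.eval_C, Subgroup.coe_one, act_one,
    sub_self]⟩

/-- Artin–Tate: R is integral and of finite type, hence finite, over R^G. -/
instance : Algebra.FiniteType K (invariants G) := by
  have : Algebra.FiniteType (invariants G) (MvPolynomial (Fin n) K) :=
    Algebra.FiniteType.of_restrictScalars_finiteType K _ _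
  have : Module.Finite (invariants G) (MvPolynomial (Fin n) K) := Algebra.IsIntegral.finite
  exact ⟨fg_of_fg_of_fg K (invariants G) (MvPolynomial (Fin n) K) Algebra.FiniteType.out
    Module.Finite.fg_top Subtype.val_injective⟩

instance : IsNoetherianRing (invariants G) := Algebra.FiniteType.isNoetherianRing K _

/-- The ideal of `R` generated by the homogeneous maximal ideal of `R^G` is `𝔪`-primary. -/
lemma exists_maxIdeal_pow_le :
    ∃ N : ℕ, maxIdeal K n ^ N ≤
      (invMaxIdeal G).map (algebraMap (invariants G) (MvPolynomial (Fin n) K)) := by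
  refine Ideal.exists_pow_le_of_le_radical_of_fg (Ideal.span_le.2 ?_) (IsNoetherian.noetherian _)
  rintro _ ⟨i, rfl⟩
  obtain ⟨p, hmonic, hp⟩ := exists_orbit_polynomial G (X i)
  set ι := algebraMap (invariants G) (MvPolynomial (Fin n) K)
  have hcoeff : ∀ j < p.natDegree, p.coeff j ∈ invMaxIdeal G := by
    intro j hj
    rw [invMaxIdeal_eq_ker, RingHom.mem_ker]
    -- Each g(x_i) vanishes at the origin, so the orbit polynomial specializes there to a power of T
    -- and its lower coefficients lie in 𝔫.
    have h0 : (p.map ι).map ((aeval (0 : Fin n → K) : MvPolynomial (Fin n) K →ₐ[K] K) : _ →+* K) =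
        Polynomial.X ^ Fintype.card G := by
      rw [hp, Polynomial.map_prod]
      refine (Finset.prod_congr rfl fun g _ => ?_).trans (Finset.prod_const _)
      rw [Polynomial.map_sub, Polynomial.map_X, Polynomial.map_C, act_X]
      simp
    have hdeg : p.natDegree = Fintype.card G := by
      rw [← hmonic.natDegree_map ι, ← (hmonic.map ι).natDegree_map
        ((aeval (0 : Fin n → K) : MvPolynomial (Fin n) K →ₐ[K] K) : _ →+* K), h0, Polynomial.natDegree_X_pow]
    have h1 := congrArg (Polynomial.coeff · j) h0
    simp only [Polynomial.coeff_map, Polynomial.coeff_X_pow] at h1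
    rw [if_neg (hdeg ▸ hj.ne)] at h1
    exact h1
  refine Ideal.mem_radical_iff.2 ⟨p.natDegree, ?_⟩
  have hroot : (p.map ι).eval (X i) = 0 := by
    rw [hp, Polynomial.eval_prod]
    refine Finset.prod_eq_zero (Finset.mem_univ (1 : G)) ?_
    rw [Polynomial.eval_sub, Polynomial.eval_X, Polynomial.eval_C, Subgroup.coe_one, act_one,
      sub_self]
  rw [Polynomial.eval_eq_sum_range, hmonic.natDegree_map, Finset.sum_range_succ,
    ← hmonic.natDegree_map ι, (hmonic.map ι).coeff_natDegree, one_mul,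
    hmonic.natDegree_map, add_comm, add_eq_zero_iff_eq_neg] at hroot
  rw [hroot]
  refine neg_mem (sum_mem fun j hj => Ideal.mul_mem_right _ _ ?_)
  rw [Polynomial.coeff_map]
  exact Ideal.mem_map_of_mem ι (hcoeff j (Finset.mem_range.1 hj))

/-- Local cohomology over `R^G` vanishes above degree `n`. -/
lemma H.subsingleton_of_gt (M : ModuleCat.{u} (invariants G)) {i : ℕ} (hi : n < i) :
    Subsingleton (H (invMaxIdeal G) i M) := by
  obtain ⟨s, θ, y, hθ, hs, hy, b, hb, k, hk⟩ := exists_parameters (augmentation G) ⊥ bot_le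
  rw [← invMaxIdeal_eq_ker] at hy hb hk
  -- R^G embeds in R, which bounds the number of parameters.
  have hsn : s ≤ n := by
    let e : (invariants G ⧸ (⊥ : Ideal (invariants G))) →ₐ[K] MvPolynomial (Fin n) K :=
      (invariants G).val.comp (AlgEquiv.quotientBot K (invariants G)).toAlgHom
    exact le_of_injective_mvPolynomial (e.comp θ)
      ((Subtype.val_injective.comp (AlgEquiv.quotientBot K _).injective).comp hθ)
  refine H.subsingleton_of_card_lt hy hb hk M ?_ (by omega)
  intro a ha x
  exact ⟨1, by rw [pow_one, (Ideal.mem_bot).1 ha, zero_smul]⟩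

/-- Without transvections, the local cohomology over `R^G` of a module killed by the image of the
transfer vanishes from degree `n - 1` on. -/
lemma H.subsingleton_of_transfer_smul (hG : ∀ g ∈ G, ¬ IsTransvection g)
    (M : ModuleCat.{u} (invariants G)) (hM : ∀ r (x : M), transfer G r • x = 0) {i : ℕ}
    (hi : n ≤ i + 1) : Subsingleton (H (invMaxIdeal G) i M) := by
  classical
  let S : Finset G := Finset.univ.filter fun g =>
    2 ≤ (((g : GL (Fin n) K) : Matrix (Fin n) (Fin n) K) - 1).rank
  let ι := algebraMap (invariants G) (MvPolynomial (Fin n) K)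
  let 𝔡 : Ideal (invariants G) := (S.inf fun g => fixIdeal (g : GL (Fin n) K)).comap ι
  -- By integrality a prime over the image of the transfer is contracted from a prime P of R, and P
  -- contains `fixIdeal g` for some g in S.
  have hrad : 𝔡 ≤ Ideal.radical (LinearMap.range (transfer G)) := by
    rw [Ideal.radical_eq_sInf]
    refine le_sInf fun p hp => ?_
    obtain ⟨htr, hprime⟩ := hp
    obtain ⟨P, -, hP, hPp⟩ := Ideal.exists_ideal_over_prime_of_isIntegral (S := MvPolynomial (Fin n) K)
      p ⊥ (by
        intro a ha
        have : a = 0 := Subtype.ext ((Ideal.mem_bot).1 ha)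
        rw [this]
        exact zero_mem _)
    obtain ⟨g, hg, hgP⟩ := exists_fixIdeal_le hG P fun r => by
      have : transfer G r ∈ P.comap ι := hPp ▸ htr ⟨r, rfl⟩
      exact this
    rw [← hPp]
    exact Ideal.comap_mono ((Finset.inf_le (Finset.mem_filter.2 ⟨Finset.mem_univ g, hg⟩)).trans hgP)
  have htors : IsTors (𝔡 : Set (invariants G)) M := by
    intro a ha x
    obtain ⟨k, r, hr⟩ := hrad ha
    exact ⟨k, hr ▸ hM r x⟩
  -- For n ≤ 1 the set S is empty and 𝔡 is the unit ideal, so the second case covers small n.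
  by_cases h𝔡 : 𝔡 ≤ invMaxIdeal G
  · rw [invMaxIdeal_eq_ker] at h𝔡
    obtain ⟨s, θ, y, hθ, hs, hy, b, hb, k, hk⟩ := exists_parameters (augmentation G) 𝔡 h𝔡
    rw [← invMaxIdeal_eq_ker] at hy hb hk
    have hsn : s + 2 ≤ n := by
      let η : (g : GL (Fin n) K) → invariants G →ₐ[K] MvPolynomial (Fin n) K ⧸ fixIdeal g :=
        fun g => (Ideal.Quotient.mkₐ K (fixIdeal g)).comp (invariants G).val
      have hη : ∀ g ∈ S, ∀ a ∈ 𝔡, η g a = 0 := fun g hg a ha =>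
        Ideal.Quotient.eq_zero_iff_mem.2 (Finset.inf_le (f := fun g : G => fixIdeal g.1) hg ha)
      -- If s + 2 > n, then θ followed by A / 𝔡 → R / `fixIdeal g` has a nonzero kernel element for
      -- each g in S. Their product dies in every quotient, hence in A / 𝔡, although θ is injective.
      by_contra hlt
      have hker : ∀ g : S, ∃ f : MvPolynomial (Fin s) K, f ≠ 0 ∧
          Ideal.Quotient.liftₐ 𝔡 (η g.1.1) (hη g.1 g.2) (θ f) = 0 := by
        intro g
        by_contra! hf
        have := add_rank_le_of_injective g.1.1
          ((Ideal.Quotient.liftₐ 𝔡 (η g.1.1) (hη g.1 g.2)).comp θ)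
          ((injective_iff_map_eq_zero _).2 fun f => not_imp_not.1 (hf f))
        have h2 := (Finset.mem_filter.1 g.2).2
        omega
      choose f hf0 hf using hker
      refine (Finset.prod_ne_zero_iff.2 fun g (_ : g ∈ Finset.univ) => hf0 g) (hθ ?_)
      rw [map_zero]
      obtain ⟨a, ha⟩ := Ideal.Quotient.mk_surjective (θ (∏ g, f g))
      rw [← ha, Ideal.Quotient.eq_zero_iff_mem]
      refine (Submodule.mem_finsetInf).2 fun g hg => ?_
      have h3 : Ideal.Quotient.liftₐ 𝔡 (η g.1) (hη g hg) (θ (∏ g, f g)) = 0 := by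
        rw [map_prod, map_prod]
        exact Finset.prod_eq_zero (Finset.mem_univ ⟨g, hg⟩) (hf ⟨g, hg⟩)
      rw [← ha] at h3
      exact Ideal.Quotient.eq_zero_iff_mem.1 h3
    exact H.subsingleton_of_card_lt hy hb hk M htors (by omega)
  · obtain ⟨d, hd, hdn⟩ := Set.not_subset.1 h𝔡
    obtain ⟨k, r, hr⟩ := hrad hd
    have hdk : d ^ k ∉ invMaxIdeal G := fun h =>
      hdn (Ideal.IsPrime.mem_of_pow_mem inferInstance k h)
    rw [invMaxIdeal_eq_ker, RingHom.mem_ker] at hdk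
    set c := augmentation G (d ^ k)
    -- This element of 𝔫 acts as the identity, since d^k lies in the image of the transfer and so
    -- kills M.
    refine H.subsingleton_of_bijective (f := 1 - algebraMap K _ c⁻¹ * d ^ k) ?_ M ?_ i
    · rw [invMaxIdeal_eq_ker, RingHom.mem_ker, map_sub, map_one, map_mul, AlgHom.commutes]
      change 1 - c⁻¹ * c = 0
      rw [inv_mul_cancel₀ hdk, sub_self]
    · have : (fun x : M => (1 - algebraMap K _ c⁻¹ * d ^ k) • x) = id := by
        funext x
        rw [sub_smul, one_smul, mul_smul, ← hr, hM, smul_zero, sub_zero, id]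
      rw [this]
      exact Function.bijective_id

end Invariants

/-! ### The complex over the invariant ring and its top local cohomology -/

section ExactSequence

/-- The hypothesis kills the source of the connecting homomorphism. It is vacuous in degree zero,
where injectivity comes from that of S.f. -/
lemma H.push_injective {A : Type u} [CommRing A] {I : Ideal A} {S : ShortComplex (ModuleCat.{u} A)}
    (hS : S.ShortExact) {i : ℕ} (h : ∀ j, j + 1 = i → Subsingleton (H I j S.X₃)) :
    Function.Injective (H.push (I := I) i S.f) := by
  cases i with
  | zero =>
    intro x y hxy
    apply H.eval_injective
    apply (ModuleCat.mono_iff_injective S.f).1 hS.mono_f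
    have := congrArg (H.eval I S.X₂) hxy
    rwa [H.eval_push, H.eval_push] at this
  | succ j =>
    refine (injective_iff_map_eq_zero _).2 fun x hx => ?_
    obtain ⟨y, rfl⟩ := H.exists_connecting_eq hS x hx
    rw [(h j rfl).elim y 0, map_zero]

/-- Compatibility of restriction along `φ` with the action of an endomorphism `σ` over `φ`. -/
lemma H.res_map_twist {A B : Type u} [CommRing A] [CommRing B] (φ : A →+* B) {I : Ideal A}
    {J : Ideal B} (h : I ≤ J.comap φ) (σ : B →+* B) (hσ : J ≤ J.comap σ)
    (hσφ : ∀ a, σ (φ a) = φ a) {M : ModuleCat.{u} B} (ψ : (ModuleCat.restrictScalars σ).obj M ⟶ M)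
    (γ : (ModuleCat.restrictScalars φ).obj M ⟶ (ModuleCat.restrictScalars φ).obj M)
    (hγ : ∀ x : M, γ.hom x = ψ.hom x) (i : ℕ) (x : H J i M) :
    H.res φ h i M (H.map σ hσ i ψ x) = H.push i γ (H.res φ h i M x) := by
  -- Since σ fixes the image of φ, the identity on elements compares the two restrictions.
  let τ : ModuleCat.restrictScalars.{u} σ ⋙ ModuleCat.restrictScalars φ ⟶
      ModuleCat.restrictScalars φ :=
    { app := fun M => ModuleCat.ofHom
        (X := (ModuleCat.restrictScalars φ).obj ((ModuleCat.restrictScalars σ).obj M))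
        (Y := (ModuleCat.restrictScalars φ).obj M)
        { toFun := fun x : M => x
          map_add' := fun _ _ => rfl
          map_smul' := fun a (x : M) => by
            change σ (φ a) • x = φ a • x
            rw [hσφ] }
      naturality := fun _ _ _ => rfl }
  have hτ : ∀ t, quotPowChange φ h t ≫ (ModuleCat.restrictScalars φ).map (quotPowChange σ hσ t) ≫
      τ.app _ = quotPowChange φ h t := by
    intro t
    apply ModuleCat.hom_ext
    refine LinearMap.ext fun x => ?_
    obtain ⟨a, rfl⟩ := Ideal.Quotient.mk_surjective (I := I ^ t) x
    change Ideal.Quotient.mk (J ^ t) (σ (φ a)) = Ideal.Quotient.mk (J ^ t) (φ a)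
    rw [hσφ]
  have hψ : τ.app M ≫ γ = (ModuleCat.restrictScalars φ).map ψ :=
    ModuleCat.hom_ext (LinearMap.ext hγ)
  rw [H.map_eq_push_res, H.res_push, ← H.res_res φ h σ hσ τ hτ x, H.push_push, hψ]

/-- Given `P → X → W` with composite zero such that the cokernel of `X → W` and the homology at
`X` are killed by elements of `t`, local cohomology in a top degree `i` is exact at `X` and `W`
provided that modules killed by `t` have none in degrees `i - 1` and `i`. -/
lemma H.exact_of_smul {A : Type u} [CommRing A] {I : Ideal A} {P X W : ModuleCat.{u} A}
    (α : P ⟶ X) (β : X ⟶ W) (hαβ : α ≫ β = 0) (t : Set A) {i : ℕ}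
    (htop : ∀ M : ModuleCat.{u} A, Subsingleton (H I (i + 1) M))
    (ht : ∀ M : ModuleCat.{u} A, (∀ a ∈ t, ∀ x : M, a • x = 0) → ∀ j, i ≤ j + 1 → j ≤ i →
      Subsingleton (H I j M))
    (hW : ∀ a ∈ t, ∀ w : W, a • w ∈ LinearMap.range β.hom)
    (hX : ∀ a ∈ t, ∀ x : X, β.hom x = 0 → a • x ∈ LinearMap.range α.hom) :
    (∀ x : H I i X, H.push i β x = 0 → ∃ w, H.push i α w = x) ∧
      Function.Surjective (H.push (I := I) i β) := by
  -- β factors as X ↠ T ↪ W, and α as P ↠ V ↪ Z ↪ X with Z = ker β; both W / T and Z / V are killed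
  -- by t.
  let T : Submodule A W := LinearMap.range β.hom
  let e : X ⟶ ModuleCat.of A T := ModuleCat.ofHom β.hom.rangeRestrict
  let Z : ModuleCat.{u} A := ModuleCat.of A (LinearMap.ker e.hom)
  have hker := shortExact_kernel e β.hom.surjective_rangeRestrict
  have himg := shortExact_submodule T
  have he : e ≫ ModuleCat.ofHom T.subtype = β := rfl
  have hT : ∀ j, i ≤ j + 1 → j ≤ i → Subsingleton (H I j (ModuleCat.of A (W ⧸ T))) :=
    ht _ fun a ha x => by
      obtain ⟨x, rfl⟩ := T.mkQ_surjective x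
      exact (Submodule.Quotient.mk_eq_zero T).2 (hW a ha x)
  refine ⟨fun x hx => ?_, fun y => ?_⟩
  · let a : P ⟶ Z := ModuleCat.ofHom (α.hom.codRestrict _ fun y =>
      Subtype.ext (LinearMap.congr_fun (congrArg ModuleCat.Hom.hom hαβ) y))
    let V : Submodule A Z := LinearMap.range a.hom
    let a' : P ⟶ ModuleCat.of A V := ModuleCat.ofHom a.hom.rangeRestrict
    have hV := shortExact_submodule V
    have ha' := shortExact_kernel a' a.hom.surjective_rangeRestrict
    have haα : (a' ≫ ModuleCat.ofHom V.subtype) ≫ ModuleCat.ofHom (LinearMap.ker e.hom).subtype =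
        α := rfl
    have hQ : Subsingleton (H I i (ModuleCat.of A (Z ⧸ V))) :=
      ht _ (fun b hb x => by
        obtain ⟨x, rfl⟩ := V.mkQ_surjective x
        refine (Submodule.Quotient.mk_eq_zero V).2 ?_
        obtain ⟨p, hp⟩ := hX b hb x.1 (congrArg Subtype.val x.2)
        exact ⟨p, Subtype.ext hp⟩) i (Nat.le_succ i) le_rfl
    rw [← he, ← H.push_push] at hx
    -- This is where degree i − 1 is needed: it makes T ↪ W injective on H^i.
    have hx' := (map_eq_zero_iff _ (H.push_injective himg fun j hj =>
      hT j hj.ge (hj ▸ Nat.le_succ j))).1 hx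
    obtain ⟨z, hz⟩ := H.exists_push_eq hker x hx'
    obtain ⟨v, hv⟩ := H.exists_push_eq hV z (hQ.elim _ _)
    -- Surjections remain surjective on H^i because H^{i+1} vanishes.
    obtain ⟨w, hw⟩ := H.exists_push_eq_of_connecting ha' v ((htop _).elim _ _)
    refine ⟨w, ?_⟩
    rw [← haα, ← H.push_push, ← H.push_push]
    exact (congrArg _ ((congrArg _ hw).trans hv)).trans hz
  · obtain ⟨y₁, hy₁⟩ := H.exists_push_eq himg y ((hT i (Nat.le_succ i) le_rfl).elim _ _)
    obtain ⟨z, hz⟩ := H.exists_push_eq_of_connecting hker y₁ ((htop _).elim _ _)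
    refine ⟨z, ?_⟩
    rw [← he, ← H.push_push]
    exact (congrArg _ hz).trans hy₁

variable {K : Type u} [Field K] {n : ℕ} (G : Subgroup (GL (Fin n) K))

/-- The polynomial ring as a module over the invariant ring. -/
abbrev polyModule : ModuleCat.{u} (invariants G) :=
  (ModuleCat.restrictScalars (algebraMap (invariants G) (MvPolynomial (Fin n) K))).obj
    (ModuleCat.of (MvPolynomial (Fin n) K) (MvPolynomial (Fin n) K))

/-- The canonical map `H^n_𝔪(R) → H^n_𝔫(R)`. -/
def resH : HR K n →+ H (invMaxIdeal G) n (polyModule G) :=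
  H.res (algebraMap (invariants G) (MvPolynomial (Fin n) K)) (le_refl (invMaxIdeal G)) n _

/-- The action of an element of `G` on `R`, as an `R^G`-linear map. -/
def actLinear (g : G) : polyModule G ⟶ polyModule G :=
  ModuleCat.ofHom (X := polyModule G) (Y := polyModule G)
    { toFun := fun x : MvPolynomial (Fin n) K => act (g : GL (Fin n) K) x
      map_add' := map_add (act (g : GL (Fin n) K))
      map_smul' := fun a (x : MvPolynomial (Fin n) K) => by
        change act (g : GL (Fin n) K) ((a : MvPolynomial (Fin n) K) * x) =
          (a : MvPolynomial (Fin n) K) * act (g : GL (Fin n) K) x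
        rw [map_mul, a.2 g g.2] }

lemma resH_actH (g : G) (x : HR K n) :
    resH G (actH G g x) = H.push n (actLinear G g) (resH G x) :=
  H.res_map_twist (algebraMap (invariants G) (MvPolynomial (Fin n) K)) (le_refl (invMaxIdeal G))
    (act (g : GL (Fin n) K)⁻¹ : MvPolynomial (Fin n) K →+* MvPolynomial (Fin n) K)
    (maxIdeal_le_comap_act (g : GL (Fin n) K)⁻¹) (fun a => a.2 _ (G.inv_mem g.2))
    (actHom (g : GL (Fin n) K)) (actLinear G g) (fun _ => rfl) n x

variable [Fintype G]

lemma resH_bijective : Function.Bijective (resH G) := by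
  obtain ⟨N, hN⟩ := exists_maxIdeal_pow_le G
  exact H.res_bijective _ _ hN n _

lemma transferH_apply (x : HR K n) :
    transferH G x = H.push n (transferHom G) (resH G x) :=
  H.map_eq_push_res _ _ _ x

lemma actLinear_transferHom (g : G) : actLinear G g ≫ transferHom G = transferHom G := by
  apply ModuleCat.hom_ext
  refine LinearMap.ext fun (x : MvPolynomial (Fin n) K) => Subtype.ext ?_
  change ∑ h : G, act (h : GL (Fin n) K) (act (g : GL (Fin n) K) x) =
    ∑ h : G, act (h : GL (Fin n) K) x
  exact Fintype.sum_equiv (Equiv.mulLeft g) _ _ fun h => by rw [act_act]; rfl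

lemma transferH_actH (g : G) (x : HR K n) : transferH G (actH G g x) = transferH G x := by
  rw [transferH_apply, transferH_apply, resH_actH, H.push_push, actLinear_transferHom]

/-- The product of copies of `R` indexed by `G`. -/
abbrev polyModulePi : ModuleCat.{u} (invariants G) := ModuleCat.of _ (G → polyModule G)

/-- The projection to a factor. -/
def polyProj (g : G) : polyModulePi G ⟶ polyModule G :=
  ModuleCat.ofHom (X := polyModulePi G) (Y := polyModule G) (LinearMap.proj g)

/-- The `R^G`-linear map `(f_g) ↦ ∑_g (f_g - g(f_g))`. -/
def alphaHom : polyModulePi G ⟶ polyModule G :=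
  ∑ g : G, (polyProj G g - polyProj G g ≫ actLinear G g)

lemma alphaHom_apply (y : G → MvPolynomial (Fin n) K) :
    (alphaHom G).hom y = ∑ g : G, (y g - act (g : GL (Fin n) K) (y g)) := by
  refine (congrArg (fun f : polyModulePi G →ₗ[invariants G] polyModule G => f y)
    (ModuleCat.hom_sum _ _)).trans ?_
  exact (LinearMap.sum_apply _ _ _).trans (Finset.sum_congr rfl fun _ _ => rfl)

lemma alphaHom_transferHom : alphaHom G ≫ transferHom G = 0 := by
  rw [alphaHom, Preadditive.sum_comp]
  refine Finset.sum_eq_zero fun g _ => ?_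
  rw [Preadditive.sub_comp, Category.assoc, actLinear_transferHom, sub_self]

/-- Multiplication by the transfer of `r` maps the kernel of the transfer to the image of `α`. -/
lemma transfer_mul_eq (r x : MvPolynomial (Fin n) K) (hx : transfer G x = 0) :
    (transfer G r : MvPolynomial (Fin n) K) * x =
      (alphaHom G).hom fun g => act (g : GL (Fin n) K)⁻¹ r * x := by
  have h1 : ∑ g : G, act (g : GL (Fin n) K)⁻¹ r = (transfer G r : MvPolynomial (Fin n) K) :=
    Fintype.sum_equiv (Equiv.inv G) _ _ fun g => rfl
  have h2 : ∑ g : G, act (g : GL (Fin n) K) x = 0 := congrArg Subtype.val hx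
  -- The sum is Tr(r)x − r Tr(x), since g(g⁻¹(r)x) = r g(x).
  rw [alphaHom_apply, Finset.sum_sub_distrib, ← Finset.sum_mul, h1]
  simp only [map_mul, act_act, inv_mul_cancel, act_one]
  rw [← Finset.mul_sum, h2, mul_zero, sub_zero]

end ExactSequence

end LocCoh

end

theorem theorem3p1 {K : Type u} [Field K] {n : ℕ} (G : Subgroup (GL (Fin n) K)) [Fintype G]
    (hG : ∀ g ∈ G, ¬ LocCoh.IsTransvection g) :
    Function.Exact (LocCoh.alpha G) (LocCoh.transferH G) ∧
      Function.Surjective (LocCoh.transferH G) := by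
  obtain ⟨hexact, hsurj⟩ := LocCoh.H.exact_of_smul (LocCoh.alphaHom G) (LocCoh.transferHom G)
    (LocCoh.alphaHom_transferHom G) (Set.range (LocCoh.transfer G)) (i := n)
    (fun M => LocCoh.H.subsingleton_of_gt G M (Nat.lt_succ_self n))
    (fun M hM j hj _ => LocCoh.H.subsingleton_of_transfer_smul G hG M
      (fun r x => hM _ ⟨r, rfl⟩ x) hj)
    (by
      rintro _ ⟨r, rfl⟩ w
      rw [smul_eq_mul, mul_comm]
      exact Submodule.smul_mem _ w ⟨r, rfl⟩)
    (by
      rintro _ ⟨r, rfl⟩ x hx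
      exact ⟨_, (LocCoh.transfer_mul_eq G r x hx).symm⟩)
  refine ⟨fun x => ⟨fun hx => ?_, ?_⟩, fun y => ?_⟩
  · rw [LocCoh.transferH_apply] at hx
    obtain ⟨w, hxw⟩ := hexact _ hx
    -- Local cohomology of the product need not be decomposed: the components η_g come from pushing
    -- w along the projections.
    rw [LocCoh.alphaHom, LocCoh.H.push_sum] at hxw
    choose η hη using fun g : G => (LocCoh.resH_bijective G).2
      (LocCoh.H.push n (LocCoh.polyProj G g) w)
    classical
    refine ⟨DirectSum.mk _ Finset.univ fun g => η g, (LocCoh.resH_bijective G).1 ?_⟩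
    rw [LocCoh.alpha_apply, map_sum, ← hxw]
    refine Finset.sum_congr rfl fun g _ => ?_
    rw [DirectSum.mk_apply_of_mem (Finset.mem_univ g), map_sub, LocCoh.resH_actH, hη,
      LocCoh.H.push_sub, ← LocCoh.H.push_push]
  · rintro ⟨η, rfl⟩
    rw [LocCoh.alpha_apply, map_sum]
    refine Finset.sum_eq_zero fun g _ => ?_
    rw [map_sub, LocCoh.transferH_actH, sub_self]
  · obtain ⟨z, hz⟩ := hsurj y
    obtain ⟨x, rfl⟩ := (LocCoh.resH_bijective G).2 z
    exact ⟨x, (LocCoh.transferH_apply G x).trans hz⟩
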